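/- Let $(\mathcal X,\mu)$ be a probability space and $k:\mathcal X\times\mathcal X\to\mathbb R$ a measurable (symmetric) positive semi-definite kernel with $\int_{\mathcal X}k(x,x)\,d\mu(x)<\infty$. Let $\sigma_1\ge\sigma_2\ge\cdots\ge 0$ be the eigenvalues, repeated according to multiplicity and padded with zeros if only finitely many are nonzero, of the integral operator $\mathcal K:L^2(\mu)\to L^2(\mu)$, $(\mathcal Kf)(x)=\int_{\mathcal X}k(x,y)f(y)\,d\mu(y)$ (only the nonzero eigenvalues matter below). Fix points $Z=(z_i)_{i=1}^{\ell}$ in $\mathcal X$, and for points $a_1,\dots,a_p$ and $b_1,\dots,b_q$ write $k(a,b)=(k(a_i,b_j))_{i,j}$. With $A^+$ denoting the Moore–Penrose pseudo-inverse, put $k^Z(x,y)=k(x,Z)\,k(Z,Z)^+k(Z,y)$. For $X=(x_j)_{j=1}^M\in\mathcal X^M$, let $\mu_X=\frac1M\sum_{j=1}^M\delta_{x_j}$ and $h_X(x,y)=\frac1M\sum_{j=1}^M k(x,x_j)k(x_j,y)$. Choose $H\in\mathbb R^{\ell\times\ell}$ with $H^\top H=h_X(Z,Z)$ and a singular value decomposition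 $Hk(Z,Z)^+H^\top=V\operatorname{diag}(\kappa_1,\dots,\kappa_\ell)V^\top$ with $V=[v_1,\dots,v_\ell]$ orthogonal and $\kappa_1\ge\cdots\ge\kappa_\ell\ge0$. Let $f_i(x)=(H^+v_i)^\top k(Z,x)$ and $$k_X^Z(x,y)=\sum_{i=1}^{\ell}\kappa_i f_i(x)f_i(y),\qquad k_{s,X}^Z(x,y)=\sum_{i=1}^{\min(s,\ell)}\kappa_i f_i(x)f_i(y)\qquad(s\ge0).$$ For $g:\mathcal X\times\mathcal X\to\mathbb R$ write $\mu_X(g)=\int_{\mathcal X} g(x,x)\,d\mu_X(x)$. Let $M\ge1$ and let $X=(x_1,\dots,x_M)$ be an i.i.d. sample from $\mu$. Then, for every integer $s\ge0$ and however $H$ and the singular value decomposition are chosen for each sample, the random variables $\mu_X(k^Z-k_{s,X}^Z)$ and $\mu_X(k_X^Z-k_{s,X}^Z)$ are integrable, $\sum_{i>s}\sigma_i<\infty$, and $$\mathbb E\big[\mu_X(k^Z-k_{s,X}^Z)\big]=\mathbb E\big[\mu_X(k_X^Z-k_{s,X}^Z)\big]\le\sum_{i>s}\sigma_i .$$ 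-/

import Mathlib

open MeasureTheory ProbabilityTheory Filter Topology
open scoped Matrix ENNReal

namespace Nystrom

/-! ### The Moore–Penrose pseudo-inverse of a real matrix -/

/-- The four Penrose equations: `B` is the Moore–Penrose pseudo-inverse of `A`. -/
structure IsMoorePenrose {m n : Type*} [Fintype m] [Fintype n]
    (A : Matrix m n ℝ) (B : Matrix n m ℝ) : Prop where
  mul_mul_self : A * B * A = A
  self_mul_mul : B * A * B = B
  left_symm : (A * B)ᵀ = A * B
  right_symm : (B * A)ᵀ = B * A

theorem IsMoorePenrose.unique {m n : Type*} [Fintype m] [Fintype n]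
    {A : Matrix m n ℝ} {B C : Matrix n m ℝ}
    (hB : IsMoorePenrose A B) (hC : IsMoorePenrose A C) : B = C := by
  have h1 : A * B = A * C := by
    calc A * B = (A * B)ᵀ := hB.left_symm.symm
      _ = (A * C * (A * B))ᵀ := by rw [← Matrix.mul_assoc, hC.mul_mul_self]
      _ = A * B * (A * C) := by rw [Matrix.transpose_mul, hB.left_symm, hC.left_symm]
      _ = A * C := by rw [← Matrix.mul_assoc, hB.mul_mul_self]
  have h2 : B * A = C * A := by
    calc B * A = (B * A)ᵀ := hB.right_symm.symm
      _ = (B * A * (C * A))ᵀ := by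
          rw [Matrix.mul_assoc B A, ← Matrix.mul_assoc A C, hC.mul_mul_self]
      _ = C * A * (B * A) := by rw [Matrix.transpose_mul, hB.right_symm, hC.right_symm]
      _ = C * A := by rw [Matrix.mul_assoc C A, ← Matrix.mul_assoc A B, hB.mul_mul_self]
  calc B = B * A * B := hB.self_mul_mul.symm
    _ = C * (A * B) := by rw [h2, Matrix.mul_assoc]
    _ = C := by rw [h1, ← Matrix.mul_assoc, hC.self_mul_mul]

theorem exists_isMoorePenrose_of_symm {n : Type*} [Fintype n]
    (S : Matrix n n ℝ) (hS : S.IsHermitian) :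
    ∃ T : Matrix n n ℝ, Tᵀ = T ∧ IsMoorePenrose S T := by
  classical
  obtain ⟨U, d, hU, hd⟩ : ∃ (U : Matrix n n ℝ) (d : n → ℝ),
      Uᵀ * U = 1 ∧ S = U * Matrix.diagonal d * Uᵀ := by
    refine ⟨hS.eigenvectorUnitary, hS.eigenvalues, ?_, ?_⟩
    · have := Unitary.coe_star_mul_self hS.eigenvectorUnitary
      simpa [Matrix.star_eq_conjTranspose, Matrix.conjTranspose_eq_transpose_of_trivial] using this
    · have := hS.spectral_theorem
      rw [Unitary.conjStarAlgAut_apply] at this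
      simpa [Matrix.star_eq_conjTranspose, Matrix.conjTranspose_eq_transpose_of_trivial,
        Function.comp_def] using this
  have key : ∀ a b : n → ℝ, (U * Matrix.diagonal a * Uᵀ) * (U * Matrix.diagonal b * Uᵀ)
      = U * Matrix.diagonal (fun i => a i * b i) * Uᵀ := by
    intro a b
    calc _ = U * Matrix.diagonal a * (Uᵀ * U) * Matrix.diagonal b * Uᵀ := by
          simp only [Matrix.mul_assoc]
      _ = _ := by rw [hU, Matrix.mul_one, Matrix.mul_assoc U, Matrix.diagonal_mul_diagonal]
  have symm : ∀ a : n → ℝ, (U * Matrix.diagonal a * Uᵀ)ᵀ = U * Matrix.diagonal a * Uᵀ := by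
    intro a
    simp [Matrix.transpose_mul, Matrix.mul_assoc]
  refine ⟨U * Matrix.diagonal (fun i => (d i)⁻¹) * Uᵀ, symm _, ?_, ?_, ?_, ?_⟩
  · rw [hd, key, key]
    congr 3; ext i
    by_cases h : d i = 0 <;> simp [h]
  · rw [hd, key, key]
    congr 3; ext i
    by_cases h : d i = 0 <;> simp [h]
  · rw [hd, key, symm]
  · rw [hd, key, symm]

theorem exists_isMoorePenrose {m n : Type*} [Fintype m] [Fintype n] (A : Matrix m n ℝ) :
    ∃ B : Matrix n m ℝ, IsMoorePenrose A B := by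
  classical
  obtain ⟨T, hT, h1, h2, h3, h4⟩ := exists_isMoorePenrose_of_symm (Aᵀ * A)
    (by simpa [Matrix.conjTranspose_eq_transpose_of_trivial] using
      Matrix.isHermitian_conjTranspose_mul_self A)
  have h5 : A * T * Aᵀ * A = A := by
    have h0 : (A * T * Aᵀ * A - A)ᴴ * (A * T * Aᵀ * A - A) = 0 := by
      have e : Aᵀ * (A * T * Aᵀ * A - A) = 0 := by
        rw [Matrix.mul_sub, sub_eq_zero]
        simpa only [Matrix.mul_assoc] using h1
      rw [Matrix.conjTranspose_eq_transpose_of_trivial, Matrix.transpose_sub, Matrix.sub_mul]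
      simp only [Matrix.transpose_mul, Matrix.transpose_transpose, Matrix.mul_assoc] at e ⊢
      rw [e]; simp
    exact sub_eq_zero.1 (Matrix.conjTranspose_mul_self_eq_zero.1 h0)
  refine ⟨T * Aᵀ, ?_, ?_, ?_, ?_⟩
  · simpa only [Matrix.mul_assoc] using h5
  · rw [Matrix.mul_assoc T Aᵀ A, ← Matrix.mul_assoc _ T Aᵀ, h2]
  · simp [Matrix.transpose_mul, hT, Matrix.mul_assoc]
  · rw [Matrix.mul_assoc, h4]

/-- The Moore–Penrose pseudo-inverse `A⁺` of a real matrix. -/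
noncomputable def pinv {m n : Type*} [Fintype m] [Fintype n] (A : Matrix m n ℝ) : Matrix n m ℝ :=
  (exists_isMoorePenrose A).choose

theorem pinv_spec {m n : Type*} [Fintype m] [Fintype n] (A : Matrix m n ℝ) :
    IsMoorePenrose A (pinv A) :=
  (exists_isMoorePenrose A).choose_spec

/-! ### Kernels and their integral operators -/

/-- `k` is a measurable (symmetric) positive semi-definite kernel whose diagonal is
`μ`-integrable. -/
structure IsIntegrableKernel {E : Type*} [MeasurableSpace E] (k : E → E → ℝ) (μ : Measure E) :
    Prop where
  posSemidef : (Matrix.of k).PosSemidef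
  measurable : Measurable (Function.uncurry k)
  integrable_diag : Integrable (fun x => k x x) μ

namespace IsIntegrableKernel

variable {E : Type*} [MeasurableSpace E] {k : E → E → ℝ} {μ : Measure E}

theorem diag_nonneg (hk : IsIntegrableKernel k μ) (x : E) : 0 ≤ k x x :=
  hk.posSemidef.diag_nonneg (i := x)

theorem abs_le (hk : IsIntegrableKernel k μ) (x y : E) :
    |k x y| ≤ √(k x x) * √(k y y) := by
  have h := (hk.posSemidef.submatrix ![x, y]).det_nonneg
  have hs : k y x = k x y := by simpa using hk.posSemidef.isHermitian.apply x y
  rw [Matrix.det_fin_two] at h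
  simp only [Matrix.submatrix_apply, Matrix.of_apply, Matrix.cons_val_zero,
    Matrix.cons_val_one] at h
  rw [hs] at h
  rw [← Real.sqrt_mul (hk.diag_nonneg x)]
  exact Real.abs_le_sqrt (by nlinarith)

theorem memLp_sqrt_diag (hk : IsIntegrableKernel k μ) : MemLp (fun x => √(k x x)) 2 μ := by
  have hm : Measurable fun x => √(k x x) :=
    (hk.measurable.comp (measurable_id.prodMk measurable_id)).sqrt
  rw [memLp_two_iff_integrable_sq hm.aestronglyMeasurable]
  exact hk.integrable_diag.congr (ae_of_all _ fun x => (Real.sq_sqrt (hk.diag_nonneg x)).symm)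

theorem integrable_sqrt_mul (hk : IsIntegrableKernel k μ) (f : Lp ℝ 2 μ) :
    Integrable (fun y => √(k y y) * |f y|) μ :=
  hk.memLp_sqrt_diag.integrable_mul (Lp.memLp f).abs

theorem integrable_mul (hk : IsIntegrableKernel k μ) (f : Lp ℝ 2 μ) (x : E) :
    Integrable (fun y => k x y * f y) μ := by
  refine ((hk.integrable_sqrt_mul f).const_mul √(k x x)).mono' ?_ (ae_of_all _ fun y => ?_)
  · exact ((hk.measurable.comp measurable_prodMk_left).aestronglyMeasurable).mul
      (Lp.aestronglyMeasurable f)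
  · rw [norm_mul, Real.norm_eq_abs, Real.norm_eq_abs, ← mul_assoc]
    exact mul_le_mul_of_nonneg_right (hk.abs_le x y) (abs_nonneg _)

theorem abs_integral_le (hk : IsIntegrableKernel k μ) (f : Lp ℝ 2 μ) (x : E) :
    |∫ y, k x y * f y ∂μ| ≤ (∫ y, √(k y y) * |f y| ∂μ) * √(k x x) := by
  rw [mul_comm, ← integral_const_mul, ← Real.norm_eq_abs]
  refine norm_integral_le_of_norm_le ((hk.integrable_sqrt_mul f).const_mul √(k x x))
    (ae_of_all _ fun y => ?_)
  rw [norm_mul, Real.norm_eq_abs, Real.norm_eq_abs, ← mul_assoc]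
  exact mul_le_mul_of_nonneg_right (hk.abs_le x y) (abs_nonneg _)

theorem memLp_integral [SFinite μ] (hk : IsIntegrableKernel k μ) (f : Lp ℝ 2 μ) :
    MemLp (fun x => ∫ y, k x y * f y ∂μ) 2 μ := by
  refine hk.memLp_sqrt_diag.of_le_mul (c := ∫ y, √(k y y) * |f y| ∂μ) ?_ (ae_of_all _ fun x => ?_)
  · have : StronglyMeasurable (Function.uncurry fun x y => k x y * f y) :=
      hk.measurable.stronglyMeasurable.mul ((Lp.stronglyMeasurable f).comp_measurable measurable_snd)
    exact this.integral_prod_right.aestronglyMeasurable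
  · rw [Real.norm_eq_abs, Real.norm_of_nonneg (Real.sqrt_nonneg _)]
    exact hk.abs_integral_le f x

theorem integral_sqrt_mul_le (hk : IsIntegrableKernel k μ) (f : Lp ℝ 2 μ) :
    ∫ y, √(k y y) * |f y| ∂μ ≤ ‖hk.memLp_sqrt_diag.toLp‖ * ‖f‖ := by
  have h := real_inner_le_norm (hk.memLp_sqrt_diag.toLp) |f|
  rw [norm_abs_eq_norm, L2.inner_def] at h
  refine le_trans (le_of_eq (integral_congr_ae ?_)) h
  filter_upwards [hk.memLp_sqrt_diag.coeFn_toLp, Lp.coeFn_abs f] with y h1 h2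
  rw [h1, h2]
  simp [mul_comm]

/-- The integral operator `𝒦 : L²(μ) → L²(μ)`, `(𝒦 f)(x) = ∫ k(x, y) f(y) dμ(y)`. -/
noncomputable def integralOperator [SFinite μ] (hk : IsIntegrableKernel k μ) :
    Lp ℝ 2 μ →L[ℝ] Lp ℝ 2 μ :=
  LinearMap.mkContinuous
    { toFun := fun f => (hk.memLp_integral f).toLp
      map_add' := fun f g => by
        rw [← MemLp.toLp_add, MemLp.toLp_eq_toLp_iff]
        refine ae_of_all _ fun x => ?_
        simp only [Pi.add_apply]
        rw [← integral_add (hk.integrable_mul f x) (hk.integrable_mul g x)]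
        refine integral_congr_ae ?_
        filter_upwards [Lp.coeFn_add f g] with y hy
        rw [hy, Pi.add_apply, mul_add]
      map_smul' := fun c f => by
        rw [RingHom.id_apply, ← MemLp.toLp_const_smul, MemLp.toLp_eq_toLp_iff]
        refine ae_of_all _ fun x => ?_
        simp only [Pi.smul_apply, smul_eq_mul]
        rw [← integral_const_mul]
        refine integral_congr_ae ?_
        filter_upwards [Lp.coeFn_smul c f] with y hy
        rw [hy, Pi.smul_apply, smul_eq_mul]
        ring }
    (‖hk.memLp_sqrt_diag.toLp‖ * ‖hk.memLp_sqrt_diag.toLp‖) fun f => by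
      refine (Lp.norm_le_mul_norm_of_ae_le_mul (g := hk.memLp_sqrt_diag.toLp)
        (c := ∫ y, √(k y y) * |f y| ∂μ) ?_).trans ?_
      · filter_upwards [(hk.memLp_integral f).coeFn_toLp, hk.memLp_sqrt_diag.coeFn_toLp]
          with x h1 h2
        simp only [LinearMap.coe_mk, AddHom.coe_mk]
        rw [h1, h2, Real.norm_eq_abs, Real.norm_of_nonneg (Real.sqrt_nonneg _)]
        exact hk.abs_integral_le f x
      · calc _ ≤ (‖hk.memLp_sqrt_diag.toLp‖ * ‖f‖) * ‖hk.memLp_sqrt_diag.toLp‖ :=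
            mul_le_mul_of_nonneg_right (hk.integral_sqrt_mul_le f) (norm_nonneg _)
          _ = _ := by ring

theorem integralOperator_ae [SFinite μ] (hk : IsIntegrableKernel k μ) (f : Lp ℝ 2 μ) :
    hk.integralOperator f =ᵐ[μ] fun x => ∫ y, k x y * f y ∂μ :=
  (hk.memLp_integral f).coeFn_toLp

end IsIntegrableKernel

/-- `σ 0 ≥ σ 1 ≥ ⋯ ≥ 0` is the non-increasing enumeration of the nonzero eigenvalues of the
(compact, positive) operator `T`, every nonzero eigenvalue being repeated according to its
multiplicity; the sequence is padded with zeros if there are only finitely many of them. -/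
structure IsEigenvalueSeq {H : Type*} [NormedAddCommGroup H] [NormedSpace ℝ H]
    (T : H →L[ℝ] H) (σ : ℕ → ℝ) : Prop where
  antitone : Antitone σ
  tendsto_zero : Tendsto σ atTop (𝓝 0)
  multiplicity : ∀ r : ℝ, r ≠ 0 → {i | σ i = r}.encard =
    Cardinal.toENat (Module.rank ℝ (Module.End.eigenspace (T : H →ₗ[ℝ] H) r))

/-! ### Nyström kernels -/

section Kernels

variable {E : Type*} {l : ℕ}

/-- The Gram matrix `k(Z, Z)`. -/
def gram (k : E → E → ℝ) (Z : Fin l → E) : Matrix (Fin l) (Fin l) ℝ :=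
  Matrix.of fun i j => k (Z i) (Z j)

/-- The column vector `k(Z, x)`. -/
def kvec (k : E → E → ℝ) (Z : Fin l → E) (x : E) : Fin l → ℝ := fun i => k (Z i) x

/-- `k^Z(x, y) = k(x, Z) k(Z, Z)⁺ k(Z, y)`. -/
noncomputable def nystromKernel (k : E → E → ℝ) (Z : Fin l → E) (x y : E) : ℝ :=
  (fun i => k x (Z i)) ⬝ᵥ (pinv (gram k Z) *ᵥ kvec k Z y)

variable [MeasurableSpace E]

/-- `ν(h) = ∫ h(x, x) dν(x)`. -/
noncomputable def diagIntegral (ν : Measure E) (h : E → E → ℝ) : ℝ := ∫ x, h x x ∂ν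

/-- The equally weighted empirical measure `μ_X = (1/M) ∑ⱼ δ_{xⱼ}`. -/
noncomputable def empiricalMeasure {M : ℕ} (X : Fin M → E) : Measure E :=
  (M : ℝ≥0∞)⁻¹ • ∑ j, Measure.dirac (X j)

/-- `h_ν(x, y) = ∫ k(x, t) k(t, y) dν(t)`. -/
noncomputable def squareKernel (k : E → E → ℝ) (ν : Measure E) (x y : E) : ℝ :=
  ∫ t, k x t * k t y ∂ν

/-- The matrices from which the Mercer decomposition of `k^Z` with respect to `ν` is computed:
some factorization `h_ν(Z, Z) = Hᵀ H` and some singular value decomposition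
`H k(Z, Z)⁺ Hᵀ = V diag(κ₁, …, κ_ℓ) Vᵀ` with `V` orthogonal and `κ₁ ≥ ⋯ ≥ κ_ℓ ≥ 0`. -/
structure MercerData (k : E → E → ℝ) (Z : Fin l → E) (ν : Measure E) where
  H : Matrix (Fin l) (Fin l) ℝ
  V : Matrix (Fin l) (Fin l) ℝ
  κ : Fin l → ℝ
  factor : Hᵀ * H = gram (squareKernel k ν) Z
  orthogonal : V ∈ Matrix.orthogonalGroup (Fin l) ℝ
  antitone : Antitone κ
  nonneg : ∀ i, 0 ≤ κ i
  svd : H * pinv (gram k Z) * Hᵀ = V * Matrix.diagonal κ * Vᵀ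

namespace MercerData

variable {k : E → E → ℝ} {Z : Fin l → E} {ν : Measure E}

/-- `f_i = (H⁺ v_i)ᵀ k(Z, ·)`, where `v_i` is the `i`-th column of `V`. -/
noncomputable def f (D : MercerData k Z ν) (i : Fin l) (x : E) : ℝ :=
  (pinv D.H *ᵥ D.V.col i) ⬝ᵥ kvec k Z x

/-- `k_ν^Z(x, y) = ∑_{i=1}^ℓ κ_i f_i(x) f_i(y)`. -/
noncomputable def kernel (D : MercerData k Z ν) (x y : E) : ℝ :=
  ∑ i, D.κ i * D.f i x * D.f i y

/-- `k_{s,ν}^Z(x, y) = ∑_{i=1}^s κ_i f_i(x) f_i(y)`, the first `s` terms of `k_ν^Z`. -/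
noncomputable def truncKernel (D : MercerData k Z ν) (s : ℕ) (x y : E) : ℝ :=
  ∑ i : Fin l, if (i : ℕ) < s then D.κ i * D.f i x * D.f i y else 0

end MercerData

end Kernels

end Nystrom

namespace Nystrom

/-! ### Sorted diagonalizations and the Ky Fan inequality -/

section Diagonalization

variable {l : ℕ}

theorem exists_antitone_diagonalization (A : Matrix (Fin l) (Fin l) ℝ) (hA : A.IsHermitian) :
    ∃ U ∈ Matrix.orthogonalGroup (Fin l) ℝ, ∃ d : Fin l → ℝ,
      Antitone d ∧ A = U * Matrix.diagonal d * Uᵀ := by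
  obtain ⟨U, hU, d, hd⟩ : ∃ U ∈ Matrix.orthogonalGroup (Fin l) ℝ, ∃ d : Fin l → ℝ,
      A = U * Matrix.diagonal d * Uᵀ := by
    refine ⟨hA.eigenvectorUnitary, hA.eigenvectorUnitary.2, hA.eigenvalues, ?_⟩
    have := hA.spectral_theorem
    rw [Unitary.conjStarAlgAut_apply] at this
    simpa [Matrix.star_eq_conjTranspose, Matrix.conjTranspose_eq_transpose_of_trivial,
      Function.comp_def] using this
  set e := Tuple.sort (fun i => - d i)
  have he : Monotone ((fun i => - d i) ∘ e) := Tuple.monotone_sort _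
  refine ⟨U.submatrix id e, ?_, d ∘ e, fun i j hij => neg_le_neg_iff.1 (he hij), ?_⟩
  · rw [Matrix.mem_orthogonalGroup_iff _ _]
    change U.submatrix id e * (U.submatrix id e)ᵀ = 1
    rw [Matrix.transpose_submatrix, Matrix.submatrix_mul_equiv]
    simpa using (show U * Uᵀ = 1 from (Matrix.mem_orthogonalGroup_iff _ _).1 hU)
  · rw [hd, ← Matrix.submatrix_diagonal_equiv, Matrix.transpose_submatrix,
      Matrix.submatrix_mul_equiv, Matrix.submatrix_mul_equiv]
    simp

theorem charpoly_conj_diagonal {U : Matrix (Fin l) (Fin l) ℝ}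
    (hU : U ∈ Matrix.orthogonalGroup (Fin l) ℝ) (d : Fin l → ℝ) :
    (U * Matrix.diagonal d * Uᵀ).charpoly = ∏ i, (Polynomial.X - Polynomial.C (d i)) := by
  rw [Matrix.charpoly_mul_comm, ← Matrix.mul_assoc,
    show Uᵀ * U = 1 from (Matrix.mem_orthogonalGroup_iff' _ _).1 hU, Matrix.one_mul,
    Matrix.charpoly_diagonal]

theorem eq_of_antitone_of_prod_eq {d e : Fin l → ℝ} (hd : Antitone d) (he : Antitone e)
    (h : ∏ i, (Polynomial.X - Polynomial.C (d i)) = ∏ i, (Polynomial.X - Polynomial.C (e i))) :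
    d = e := by
  have h' := congrArg Polynomial.roots h
  rw [Polynomial.roots_prod _ _ (by simp [Finset.prod_ne_zero_iff, Polynomial.X_sub_C_ne_zero]),
    Polynomial.roots_prod _ _ (by simp [Finset.prod_ne_zero_iff, Polynomial.X_sub_C_ne_zero])] at h'
  simp only [Polynomial.roots_X_sub_C, Multiset.bind_singleton, Fin.univ_val_map,
    Multiset.coe_eq_coe] at h'
  rw [← List.ofFn_inj]
  exact h'.eq_of_pairwise (fun a b _ _ h1 h2 => le_antisymm h2 h1)
    (List.sortedGE_iff_pairwise.1 hd.sortedGE_ofFn) (List.sortedGE_iff_pairwise.1 he.sortedGE_ofFn)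

theorem exists_diagonalization_transpose_mul_self {N V : Matrix (Fin l) (Fin l) ℝ}
    (hV : V ∈ Matrix.orthogonalGroup (Fin l) ℝ) {κ : Fin l → ℝ} (hκ : Antitone κ)
    (h : N * Nᵀ = V * Matrix.diagonal κ * Vᵀ) :
    ∃ U ∈ Matrix.orthogonalGroup (Fin l) ℝ, Nᵀ * N = U * Matrix.diagonal κ * Uᵀ := by
  obtain ⟨U, hU, d, hd, hA⟩ := exists_antitone_diagonalization (Nᵀ * N)
    (by simpa [Matrix.conjTranspose_eq_transpose_of_trivial] using
      Matrix.isHermitian_conjTranspose_mul_self N)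
  refine ⟨U, hU, ?_⟩
  rw [hA, eq_of_antitone_of_prod_eq hd hκ]
  rw [← charpoly_conj_diagonal hU, ← charpoly_conj_diagonal hV, ← hA, ← h,
    Matrix.charpoly_mul_comm]

theorem sum_le_sum_mul_of_antitone {κ p : Fin l → ℝ} (hκ : Antitone κ) (s : ℕ)
    (h0 : ∀ i, 0 ≤ p i) (h1 : ∀ i, p i ≤ 1)
    (hp : ∑ i, p i = ∑ i : Fin l, if s ≤ (i : ℕ) then (1 : ℝ) else 0) :
    ∑ i : Fin l, (if s ≤ (i : ℕ) then κ i else 0) ≤ ∑ i, κ i * p i := by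
  obtain ⟨c, hc1, hc2⟩ : ∃ c : ℝ, (∀ i : Fin l, (i : ℕ) < s → c ≤ κ i) ∧
      ∀ i : Fin l, s ≤ (i : ℕ) → κ i ≤ c := by
    by_cases hs : s < l
    · exact ⟨κ ⟨s, hs⟩, fun i hi => hκ (Fin.le_def.2 hi.le), fun i hi => hκ (Fin.le_def.2 hi)⟩
    · rcases Nat.eq_zero_or_pos l with rfl | hl
      · exact ⟨0, fun i => i.elim0, fun i => i.elim0⟩
      · refine ⟨κ ⟨l - 1, by omega⟩, fun i _ => hκ (Fin.le_def.2 ?_), fun i hi => ?_⟩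
        · have := i.2; simp only; omega
        · have := i.2; omega
  have key : ∀ i : Fin l, (if s ≤ (i : ℕ) then κ i else 0) - κ i * p i ≤
      c * ((if s ≤ (i : ℕ) then (1 : ℝ) else 0) - p i) := by
    intro i
    split_ifs with hi
    · nlinarith [hc2 i hi, h1 i]
    · nlinarith [hc1 i (by omega), h0 i]
  have := Finset.sum_le_sum fun i (_ : i ∈ Finset.univ) => key i
  rw [← Finset.mul_sum, Finset.sum_sub_distrib, Finset.sum_sub_distrib, hp] at this
  linarith

/-- The **Ky Fan inequality**: the sum of the smallest eigenvalues is at most the corresponding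
partial trace in any orthonormal basis. -/
theorem sum_tail_le_partial_trace {U W : Matrix (Fin l) (Fin l) ℝ}
    (hU : U ∈ Matrix.orthogonalGroup (Fin l) ℝ) (hW : W ∈ Matrix.orthogonalGroup (Fin l) ℝ)
    {κ : Fin l → ℝ} (hκ : Antitone κ) (s : ℕ) :
    ∑ i : Fin l, (if s ≤ (i : ℕ) then κ i else 0) ≤
      ∑ i : Fin l, if s ≤ (i : ℕ) then
        (Wᵀ * (U * Matrix.diagonal κ * Uᵀ) * W) i i else 0 := by
  set Q := Uᵀ * W with hQ
  have hQo : Q ∈ Matrix.orthogonalGroup (Fin l) ℝ :=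
    mul_mem (Unitary.star_mem hU : star U ∈ Matrix.orthogonalGroup (Fin l) ℝ) hW
  have e1 : ∀ i, (Wᵀ * (U * Matrix.diagonal κ * Uᵀ) * W) i i = ∑ j, κ j * Q j i ^ 2 := by
    intro i
    have : Wᵀ * (U * Matrix.diagonal κ * Uᵀ) * W = Qᵀ * Matrix.diagonal κ * Q := by
      simp [hQ, Matrix.transpose_mul, Matrix.mul_assoc]
    rw [this, Matrix.mul_apply]
    refine Finset.sum_congr rfl fun j _ => ?_
    rw [Matrix.mul_diagonal, Matrix.transpose_apply]
    ring
  have r1 : ∀ j, ∑ i, Q j i ^ 2 = 1 := fun j => by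
    have := congrFun (congrFun (show Q * Qᵀ = 1 from (Matrix.mem_orthogonalGroup_iff _ _).1 hQo) j) j
    simpa [Matrix.mul_apply, sq] using this
  have c1 : ∀ i, ∑ j, Q j i ^ 2 = 1 := fun i => by
    have := congrFun (congrFun (show Qᵀ * Q = 1 from (Matrix.mem_orthogonalGroup_iff' _ _).1 hQo) i) i
    simpa [Matrix.mul_apply, sq] using this
  refine (sum_le_sum_mul_of_antitone hκ s
    (p := fun j => ∑ i : Fin l, if s ≤ (i : ℕ) then Q j i ^ 2 else 0) ?_ ?_ ?_).trans_eq ?_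
  · exact fun j => Finset.sum_nonneg fun i _ => by split_ifs <;> positivity
  · intro j
    rw [← r1 j]
    exact Finset.sum_le_sum fun i _ => by split_ifs <;> [exact le_rfl; positivity]
  · rw [Finset.sum_comm]
    refine Finset.sum_congr rfl fun i _ => ?_
    split_ifs
    · exact c1 i
    · simp
  · simp_rw [Finset.mul_sum]
    rw [Finset.sum_comm]
    refine Finset.sum_congr rfl fun i _ => ?_
    split_ifs
    · exact (e1 i).symm
    · simp

/-- The infimum over all orthonormal bases of the partial trace of `A` over the basis vectors with
index at least `s`. -/
noncomputable def partialTraceInf (s : ℕ) (A : Matrix (Fin l) (Fin l) ℝ) : ℝ :=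
  sInf ((fun W : Matrix (Fin l) (Fin l) ℝ =>
    ∑ i : Fin l, if s ≤ (i : ℕ) then (Wᵀ * A * W) i i else 0) ''
      (Matrix.orthogonalGroup (Fin l) ℝ : Set (Matrix (Fin l) (Fin l) ℝ)))

theorem isCompact_orthogonalGroup :
    IsCompact (Matrix.orthogonalGroup (Fin l) ℝ : Set (Matrix (Fin l) (Fin l) ℝ)) := by
  have hK : IsCompact (Set.univ.pi fun _ : Fin l => Set.univ.pi fun _ : Fin l =>
      Metric.closedBall (0 : ℝ) 1) :=
    isCompact_univ_pi fun _ => isCompact_univ_pi fun _ => isCompact_closedBall _ _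
  refine hK.of_isClosed_subset ?_ fun U hU i _ j _ => ?_
  · have : (Matrix.orthogonalGroup (Fin l) ℝ : Set (Matrix (Fin l) (Fin l) ℝ)) =
        {U | Uᵀ * U = 1} := by
      ext U
      exact (Matrix.mem_orthogonalGroup_iff' _ _)
    rw [this]
    exact isClosed_eq (by fun_prop) continuous_const
  · simpa using entry_norm_bound_of_unitary hU i j

theorem continuous_partialTraceInf (s : ℕ) :
    Continuous (partialTraceInf s : Matrix (Fin l) (Fin l) ℝ → ℝ) := by
  refine isCompact_orthogonalGroup.continuous_sInf
    (f := fun A W : Matrix (Fin l) (Fin l) ℝ =>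
      ∑ i : Fin l, if s ≤ (i : ℕ) then (Wᵀ * A * W) i i else 0) ?_
  change Continuous fun x : Matrix (Fin l) (Fin l) ℝ × Matrix (Fin l) (Fin l) ℝ =>
    ∑ i : Fin l, if s ≤ (i : ℕ) then (x.2ᵀ * x.1 * x.2) i i else 0
  refine continuous_finsetSum _ fun i _ => ?_
  split_ifs
  · have : Continuous fun x : Matrix (Fin l) (Fin l) ℝ × Matrix (Fin l) (Fin l) ℝ =>
      x.2ᵀ * x.1 * x.2 := by fun_prop
    exact this.matrix_elem i i
  · exact continuous_const

theorem partialTraceInf_conj_diagonal {U : Matrix (Fin l) (Fin l) ℝ}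
    (hU : U ∈ Matrix.orthogonalGroup (Fin l) ℝ) {κ : Fin l → ℝ} (hκ : Antitone κ) (s : ℕ) :
    partialTraceInf s (U * Matrix.diagonal κ * Uᵀ) =
      ∑ i : Fin l, if s ≤ (i : ℕ) then κ i else 0 := by
  refine IsLeast.csInf_eq ⟨⟨U, hU, ?_⟩, ?_⟩
  · have : Uᵀ * (U * Matrix.diagonal κ * Uᵀ) * U = Matrix.diagonal κ := by
      have h : Uᵀ * U = 1 := (Matrix.mem_orthogonalGroup_iff' _ _).1 hU
      calc _ = (Uᵀ * U) * Matrix.diagonal κ * (Uᵀ * U) := by simp only [Matrix.mul_assoc]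
        _ = _ := by rw [h, Matrix.one_mul, Matrix.mul_one]
    simp only [this, Matrix.diagonal_apply_eq]
  · rintro _ ⟨W, hW, rfl⟩
    exact sum_tail_le_partial_trace hU hW hκ s

end Diagonalization

/-! ### Mercer decompositions with respect to an empirical measure -/

theorem nystromKernel_self {E : Type*} {k : E → E → ℝ} {l : ℕ} (hs : ∀ x y, k x y = k y x) (Z : Fin l → E) (x : E) :
    nystromKernel k Z x x = kvec k Z x ⬝ᵥ pinv (gram k Z) *ᵥ kvec k Z x := by
  rw [nystromKernel, show (fun i => k x (Z i)) = kvec k Z x from funext fun i => hs _ _]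

section Empirical

variable {E : Type*} [MeasurableSpace E] {k : E → E → ℝ} {l M : ℕ}

theorem integral_empiricalMeasure (X : Fin M → E) {g : E → ℝ} (hg : Measurable g) :
    ∫ x, g x ∂empiricalMeasure X = (M : ℝ)⁻¹ * ∑ j, g (X j) := by
  rw [empiricalMeasure, integral_smul_measure, integral_finsetSum_measure]
  · simp [integral_dirac' _ _ hg.stronglyMeasurable]
  · exact fun j _ => integrable_dirac' hg.stronglyMeasurable (by simp)

theorem measurable_kvec (hk : Measurable (Function.uncurry k)) (Z : Fin l → E) (i : Fin l) :
    Measurable fun x => kvec k Z x i :=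
  hk.comp (measurable_const.prodMk measurable_id)

theorem measurable_quadForm_kvec (hk : Measurable (Function.uncurry k)) (Z : Fin l → E)
    (T : Matrix (Fin l) (Fin l) ℝ) : Measurable fun x => kvec k Z x ⬝ᵥ T *ᵥ kvec k Z x := by
  simp only [dotProduct, Matrix.mulVec]
  exact Finset.measurable_sum _ fun i _ => (measurable_kvec hk Z i).mul
    (Finset.measurable_sum _ fun j _ => (measurable_kvec hk Z j).const_mul _)

theorem quadForm_eq_trace (T : Matrix (Fin l) (Fin l) ℝ) (v : Fin l → ℝ) :
    v ⬝ᵥ T *ᵥ v = (T * Matrix.vecMulVec v v).trace := by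
  rw [Matrix.mul_vecMulVec, Matrix.trace_vecMulVec, dotProduct_comm]

theorem gram_squareKernel_empirical (hk : Measurable (Function.uncurry k))
    (hs : ∀ x y, k x y = k y x) (Z : Fin l → E) (X : Fin M → E) :
    gram (squareKernel k (empiricalMeasure X)) Z =
      (M : ℝ)⁻¹ • ∑ j, Matrix.vecMulVec (kvec k Z (X j)) (kvec k Z (X j)) := by
  ext a b
  rw [gram, Matrix.of_apply, squareKernel, integral_empiricalMeasure]
  · simp [Matrix.sum_apply, Matrix.vecMulVec_apply, kvec, hs _ (Z b)]
  · exact (hk.comp (measurable_const.prodMk measurable_id)).mul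
      (hk.comp (measurable_id.prodMk measurable_const))

theorem integral_quadForm_empirical (hk : Measurable (Function.uncurry k))
    (hs : ∀ x y, k x y = k y x) (Z : Fin l → E) (X : Fin M → E)
    (T : Matrix (Fin l) (Fin l) ℝ) :
    (M : ℝ)⁻¹ * ∑ j, kvec k Z (X j) ⬝ᵥ T *ᵥ kvec k Z (X j) =
      (T * gram (squareKernel k (empiricalMeasure X)) Z).trace := by
  rw [gram_squareKernel_empirical hk hs, Matrix.mul_smul, Matrix.trace_smul, Matrix.mul_sum,
    Matrix.trace_sum, smul_eq_mul]
  simp only [quadForm_eq_trace]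

namespace MercerData

variable {Z : Fin l → E} {ν : Measure E}

theorem trace_pinv_mul_gram (D : MercerData k Z ν) :
    (pinv (gram k Z) * gram (squareKernel k ν) Z).trace = ∑ i, D.κ i := by
  have hV : D.Vᵀ * D.V = 1 := (Matrix.mem_orthogonalGroup_iff' _ _).1 D.orthogonal
  rw [← D.factor, ← Matrix.mul_assoc, Matrix.trace_mul_comm, ← Matrix.mul_assoc, D.svd,
    Matrix.trace_mul_comm, ← Matrix.mul_assoc, hV, Matrix.one_mul, Matrix.trace_diagonal]

theorem κ_mul_quadForm (D : MercerData k Z ν) (i : Fin l) :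
    D.κ i * ((pinv D.H *ᵥ D.V.col i) ⬝ᵥ
      gram (squareKernel k ν) Z *ᵥ (pinv D.H *ᵥ D.V.col i)) = D.κ i := by
  have hV : D.Vᵀ * D.V = 1 := (Matrix.mem_orthogonalGroup_iff' _ _).1 D.orthogonal
  rcases eq_or_ne (D.κ i) 0 with h0 | h0
  · simp [h0]
  have e1 : (D.H * pinv (gram k Z) * D.Hᵀ) *ᵥ D.V.col i = D.κ i • D.V.col i := by
    have : D.V.col i = D.V *ᵥ Pi.single i 1 := by simp
    rw [D.svd, this, Matrix.mulVec_mulVec, Matrix.mul_assoc, hV, Matrix.mul_one,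
      ← Matrix.mulVec_mulVec, Matrix.diagonal_mulVec_single, ← Matrix.mulVec_smul, mul_one]
    simp [← Pi.single_smul]
  have e2 : D.H *ᵥ (pinv D.H *ᵥ D.V.col i) = D.V.col i := by
    have h := congrArg (fun v => (D.H * pinv D.H) *ᵥ v) e1
    simp only [Matrix.mulVec_mulVec, Matrix.mulVec_smul] at h
    rw [← Matrix.mul_assoc, ← Matrix.mul_assoc, (pinv_spec D.H).mul_mul_self, e1] at h
    rw [Matrix.mulVec_mulVec]
    exact (smul_right_injective _ h0 h).symm
  have e3 : D.V.col i ⬝ᵥ D.V.col i = 1 := by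
    have := congrFun (congrFun hV i) i
    simpa [Matrix.mul_apply, dotProduct] using this
  rw [← D.factor, ← Matrix.mulVec_mulVec, Matrix.dotProduct_mulVec, Matrix.vecMul_transpose, e2, e3,
    mul_one]

end MercerData

variable {Z : Fin l → E} {X : Fin M → E}

theorem MercerData.f_mul_f (ν : Measure E) (D : MercerData k Z ν) (i : Fin l) (x : E) :
    D.f i x * D.f i x = kvec k Z x ⬝ᵥ
      Matrix.vecMulVec (pinv D.H *ᵥ D.V.col i) (pinv D.H *ᵥ D.V.col i) *ᵥ kvec k Z x := by
  rw [MercerData.f, Matrix.vecMulVec_mulVec, dotProduct_comm (kvec k Z x)]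
  simp [smul_dotProduct]

theorem MercerData.integral_κ_mul_f (hk : Measurable (Function.uncurry k))
    (hs : ∀ x y, k x y = k y x) (D : MercerData k Z (empiricalMeasure X)) (i : Fin l) :
    (M : ℝ)⁻¹ * ∑ j, D.κ i * D.f i (X j) * D.f i (X j) = D.κ i := by
  have h := D.κ_mul_quadForm i
  rw [quadForm_eq_trace, Matrix.trace_mul_comm, ← integral_quadForm_empirical hk hs] at h
  simp only [← MercerData.f_mul_f] at h
  simp only [mul_assoc, ← Finset.mul_sum]
  linarith

theorem MercerData.measurable_f (hk : Measurable (Function.uncurry k)) (ν : Measure E)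
    (D : MercerData k Z ν) (i : Fin l) : Measurable (D.f i) := by
  unfold MercerData.f dotProduct
  exact Finset.measurable_sum _ fun j _ => (measurable_kvec hk Z j).const_mul _

theorem MercerData.measurable_term (hk : Measurable (Function.uncurry k)) (ν : Measure E)
    (D : MercerData k Z ν) (i : Fin l) : Measurable fun x => D.κ i * D.f i x * D.f i x :=
  ((D.measurable_f hk ν i).const_mul _).mul (D.measurable_f hk ν i)

theorem MercerData.measurable_truncKernel (hk : Measurable (Function.uncurry k)) (ν : Measure E)
    (D : MercerData k Z ν) (s : ℕ) : Measurable fun x => D.truncKernel s x x := by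
  unfold MercerData.truncKernel
  refine Finset.measurable_sum _ fun i _ => ?_
  split_ifs
  · exact D.measurable_term hk ν i
  · exact measurable_const

theorem MercerData.average_truncKernel (hk : Measurable (Function.uncurry k))
    (hs : ∀ x y, k x y = k y x) (D : MercerData k Z (empiricalMeasure X)) (s : ℕ) :
    (M : ℝ)⁻¹ * ∑ j, D.truncKernel s (X j) (X j) =
      ∑ i : Fin l, if (i : ℕ) < s then D.κ i else 0 := by
  unfold MercerData.truncKernel
  rw [Finset.sum_comm, Finset.mul_sum]
  refine Finset.sum_congr rfl fun i _ => ?_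
  split_ifs
  · exact D.integral_κ_mul_f hk hs i
  · simp

theorem MercerData.sum_sub_sum_lt {ν : Measure E} (D : MercerData k Z ν) (s : ℕ) :
    ∑ i, D.κ i - ∑ i : Fin l, (if (i : ℕ) < s then D.κ i else 0) =
      ∑ i : Fin l, if s ≤ (i : ℕ) then D.κ i else 0 := by
  rw [← Finset.sum_sub_distrib]
  refine Finset.sum_congr rfl fun i _ => ?_
  by_cases h : (i : ℕ) < s
  · simp [h, not_le.2 h]
  · simp [h, not_lt.1 h]

theorem MercerData.diagIntegral_nystromKernel_sub (hk : Measurable (Function.uncurry k))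
    (hs : ∀ x y, k x y = k y x) (D : MercerData k Z (empiricalMeasure X)) (s : ℕ) :
    diagIntegral (empiricalMeasure X) (fun x y => nystromKernel k Z x y - D.truncKernel s x y) =
      ∑ i : Fin l, if s ≤ (i : ℕ) then D.κ i else 0 := by
  simp only [diagIntegral, nystromKernel_self hs]
  rw [integral_empiricalMeasure X ((measurable_quadForm_kvec hk Z _).fun_sub
    (D.measurable_truncKernel hk _ s)), Finset.sum_sub_distrib, mul_sub,
    integral_quadForm_empirical hk hs, D.trace_pinv_mul_gram, D.average_truncKernel hk hs,
    D.sum_sub_sum_lt]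

theorem MercerData.diagIntegral_kernel_sub (hk : Measurable (Function.uncurry k))
    (hs : ∀ x y, k x y = k y x) (D : MercerData k Z (empiricalMeasure X)) (s : ℕ) :
    diagIntegral (empiricalMeasure X) (fun x y => D.kernel x y - D.truncKernel s x y) =
      ∑ i : Fin l, if s ≤ (i : ℕ) then D.κ i else 0 := by
  have h : ∀ x y, D.kernel x y = D.truncKernel l x y := fun x y => by
    simp [MercerData.kernel, MercerData.truncKernel]
  simp only [diagIntegral, h]
  rw [integral_empiricalMeasure X ((D.measurable_truncKernel hk _ l).fun_sub
    (D.measurable_truncKernel hk _ s)), Finset.sum_sub_distrib, mul_sub,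
    D.average_truncKernel hk hs, D.average_truncKernel hk hs, ← D.sum_sub_sum_lt]
  simp

/-- If `Bᵀ B = k(Z, Z)⁺`, then the `κᵢ` are the eigenvalues of `B h_ν(Z, Z) Bᵀ`. -/
theorem MercerData.exists_diagonalization {ν : Measure E} (D : MercerData k Z ν)
    {B : Matrix (Fin l) (Fin l) ℝ} (hB : Bᵀ * B = pinv (gram k Z)) :
    ∃ U ∈ Matrix.orthogonalGroup (Fin l) ℝ,
      B * gram (squareKernel k ν) Z * Bᵀ = U * Matrix.diagonal D.κ * Uᵀ := by
  obtain ⟨U, hU, h⟩ := exists_diagonalization_transpose_mul_self (N := D.H * Bᵀ) D.orthogonal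
    D.antitone (by
      rw [← D.svd, ← hB]
      simp [Matrix.transpose_mul, Matrix.mul_assoc])
  refine ⟨U, hU, ?_⟩
  rw [← h, ← D.factor]
  simp [Matrix.transpose_mul, Matrix.mul_assoc]

theorem MercerData.sum_tail_eq_partialTraceInf {ν : Measure E} (D : MercerData k Z ν) (s : ℕ)
    {B : Matrix (Fin l) (Fin l) ℝ} (hB : Bᵀ * B = pinv (gram k Z)) :
    ∑ i : Fin l, (if s ≤ (i : ℕ) then D.κ i else 0) =
      partialTraceInf s (B * gram (squareKernel k ν) Z * Bᵀ) := by
  obtain ⟨U, hU, h⟩ := D.exists_diagonalization hB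
  rw [h, partialTraceInf_conj_diagonal hU D.antitone]

end Empirical

/-! ### Compact operators on Hilbert spaces and their eigenvalue sequences -/

section Compact

variable {H : Type*} [NormedAddCommGroup H] [InnerProductSpace ℝ H]

theorem exists_norm_apply_le_of_mem_orthogonal {F : Type*} [NormedAddCommGroup F]
    [NormedSpace ℝ F] (T : H →L[ℝ] F) (C : ℝ)
    (h : ∀ (n : ℕ) (e : Fin n → H), Orthonormal ℝ e → ∑ i, ‖T (e i)‖ ^ 2 ≤ C)
    {ε : ℝ} (hε : 0 < ε) :
    ∃ W : Submodule ℝ H, FiniteDimensional ℝ W ∧ ∀ x ∈ Wᗮ, ‖T x‖ ≤ ε * ‖x‖ := by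
  by_contra! hW
  have hW' : ∀ W : Submodule ℝ H, FiniteDimensional ℝ W → ∃ u ∈ Wᗮ, ‖u‖ = 1 ∧ ε ≤ ‖T u‖ := by
    intro W hfin
    obtain ⟨x, hx, hlt⟩ := hW W hfin
    have hx0 : x ≠ 0 := by
      rintro rfl
      simp at hlt
    have hn : 0 < ‖x‖ := norm_pos_iff.2 hx0
    refine ⟨‖x‖⁻¹ • x, Submodule.smul_mem _ _ hx, by simp [norm_smul, hn.ne'], ?_⟩
    rw [map_smul, norm_smul, norm_inv, norm_norm, inv_mul_eq_div, le_div_iff₀ hn]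
    exact hlt.le
  have key : ∀ n : ℕ, ∃ e : Fin n → H, Orthonormal ℝ e ∧ ∀ i, ε ≤ ‖T (e i)‖ := by
    intro n
    induction n with
    | zero => exact ⟨Fin.elim0, ⟨fun i => i.elim0, fun i => i.elim0⟩, fun i => i.elim0⟩
    | succ n ih =>
      obtain ⟨e, he, heT⟩ := ih
      obtain ⟨u, hu, hu1, huT⟩ := hW' (Submodule.span ℝ (Set.range e))
        (FiniteDimensional.span_of_finite ℝ (Set.finite_range e))
      have hperp : ∀ i, inner ℝ (e i) u = 0 := fun i =>
        (Submodule.mem_orthogonal _ _).1 hu _ (Submodule.subset_span ⟨i, rfl⟩)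
      refine ⟨Fin.snoc e u, ⟨fun i => ?_, fun i j hij => ?_⟩, fun i => ?_⟩
      · refine Fin.lastCases ?_ (fun i => ?_) i
        · simpa using hu1
        · simpa using he.1 i
      · revert hij
        refine Fin.lastCases ?_ (fun i => ?_) i <;> refine Fin.lastCases ?_ (fun j => ?_) j
        · exact fun hij => absurd rfl hij
        · intro _
          simpa [real_inner_comm] using hperp j
        · intro _
          simpa using hperp i
        · intro hij
          simpa using he.2 fun h => hij (by rw [h])
      · refine Fin.lastCases ?_ (fun i => ?_) i
        · simpa using huT
        · simpa using heT i
  obtain ⟨n, hn⟩ := exists_nat_gt (C / ε ^ 2)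
  obtain ⟨e, he, heT⟩ := key n
  have h1 := h n e he
  have h2 : (n : ℝ) * ε ^ 2 ≤ ∑ i, ‖T (e i)‖ ^ 2 := by
    calc (n : ℝ) * ε ^ 2 = ∑ _i : Fin n, ε ^ 2 := by simp
      _ ≤ _ := Finset.sum_le_sum fun i _ => pow_le_pow_left₀ hε.le (heT i) 2
  rw [div_lt_iff₀ (by positivity)] at hn
  linarith

/-- A Hilbert–Schmidt operator is compact. -/
theorem isCompactOperator_of_sum_norm_sq_le {F : Type*} [NormedAddCommGroup F]
    [NormedSpace ℝ F] [CompleteSpace F] (T : H →L[ℝ] F) (C : ℝ)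
    (h : ∀ (n : ℕ) (e : Fin n → H), Orthonormal ℝ e → ∑ i, ‖T (e i)‖ ^ 2 ≤ C) :
    IsCompactOperator T := by
  suffices hT : T ∈ {f : H →L[ℝ] F | IsCompactOperator f} from hT
  rw [← isClosed_setOfPred_isCompactOperator.closure_eq, Metric.mem_closure_iff]
  intro ε hε
  obtain ⟨W, hW, hWT⟩ := exists_norm_apply_le_of_mem_orthogonal T C h (half_pos hε)
  refine ⟨T ∘L W.starProjection, ?_, ?_⟩
  · have : IsCompactOperator (id : W → W) := isCompactOperator_id_iff_finiteDimensional.2 hW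
    exact ((this.clm_comp (T ∘L W.subtypeL)).comp_clm W.orthogonalProjectionOnto)
  · rw [dist_eq_norm]
    refine lt_of_le_of_lt (ContinuousLinearMap.opNorm_le_bound _ (half_pos hε).le fun x => ?_)
      (half_lt_self hε)
    have h1 : x - W.starProjection x ∈ Wᗮ := W.sub_starProjection_mem_orthogonal x
    have h2 : ‖x - W.starProjection x‖ ≤ ‖x‖ := by
      simpa [Submodule.starProjection_orthogonal] using Wᗮ.norm_starProjection_apply_le x
    calc ‖(T - T ∘L W.starProjection) x‖ = ‖T (x - W.starProjection x)‖ := by simp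
      _ ≤ ε / 2 * ‖x - W.starProjection x‖ := hWT _ h1
      _ ≤ ε / 2 * ‖x‖ := by gcongr

theorem IsEigenvalueSeq.nonneg {T : H →L[ℝ] H} {σ : ℕ → ℝ} (hσ : IsEigenvalueSeq T σ) (i : ℕ) : 0 ≤ σ i :=
  hσ.antitone.le_of_tendsto hσ.tendsto_zero i

variable [CompleteSpace H]

theorem exists_hasEigenvalue_abs_eq_norm {T : H →L[ℝ] H} (hT : IsCompactOperator T)
    (hs : T.IsSymmetric) (h0 : T ≠ 0) :
    ∃ r : ℝ, |r| = ‖T‖ ∧ Module.End.HasEigenvalue (T : H →ₗ[ℝ] H) r := by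
  have hr := T.spectralRadius_eq_nnnorm hs.isSelfAdjoint
  have hne : (spectrum ℝ T).Nonempty := by
    by_contra hempty
    rw [Set.not_nonempty_iff_eq_empty] at hempty
    rw [spectralRadius, hempty] at hr
    simp at hr
    exact h0 (nnnorm_eq_zero.1 hr.symm)
  obtain ⟨r, hrs, hrn⟩ := spectrum.exists_nnnorm_eq_spectralRadius_of_nonempty hne
  rw [hr, ENNReal.coe_inj] at hrn
  have hrn' : |r| = ‖T‖ := congrArg NNReal.toReal hrn
  refine ⟨r, hrn', (hT.hasEigenvalue_iff_mem_spectrum ?_).2 hrs⟩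
  rintro rfl
  rw [abs_zero] at hrn'
  exact h0 (norm_eq_zero.1 hrn'.symm)

variable {T : H →L[ℝ] H} {σ : ℕ → ℝ}

theorem IsEigenvalueSeq.ncard_eq (hσ : IsEigenvalueSeq T σ) (hT : IsCompactOperator T) {r : ℝ}
    (hr : r ≠ 0) :
    {i | σ i = r}.Finite ∧
      {i | σ i = r}.ncard = Module.finrank ℝ (Module.End.eigenspace (T : H →ₗ[ℝ] H) r) := by
  have hfin : FiniteDimensional ℝ (Module.End.eigenspace (T : H →ₗ[ℝ] H) r) :=
    ContinuousLinearMap.finite_dimensional_eigenspace hT r hr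
  have h := hσ.multiplicity r hr
  rw [← Module.finrank_eq_rank, Cardinal.toENat_nat] at h
  have hf : {i | σ i = r}.Finite := Set.finite_of_encard_eq_coe h
  refine ⟨hf, ?_⟩
  rw [← hf.cast_ncard_eq] at h
  exact_mod_cast h

/-- **Weyl's inequality**: if the quadratic form of `T` is at least `c ‖·‖²` on a subspace of
dimension `m + 1`, then the `m`-th eigenvalue is at least `c`. -/
theorem IsEigenvalueSeq.le_of_quadratic_lower_bound (hσ : IsEigenvalueSeq T σ)
    (hT : IsCompactOperator T) (hs : T.IsSymmetric) (hpos : ∀ f, 0 ≤ inner ℝ (T f) f)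
    {m : ℕ} {c : ℝ} (hc : 0 < c) (e : Fin (m + 1) → H) (he : LinearIndependent ℝ e)
    (h : ∀ a : Fin (m + 1) → ℝ, c * ‖∑ i, a i • e i‖ ^ 2 ≤
      inner ℝ (T (∑ i, a i • e i)) (∑ i, a i • e i)) : c ≤ σ m := by
  classical
  by_contra! hlt
  set R : Finset ℝ := ((Finset.range m).image σ).filter (c ≤ ·) with hR
  have hR0 : ∀ r : R, (r : ℝ) ≠ 0 := fun r =>
    (hc.trans_le (Finset.mem_filter.1 r.2).2).ne'
  let V : R → Submodule ℝ H := fun r => Module.End.eigenspace (T : H →ₗ[ℝ] H) r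
  have hVfin : ∀ r, FiniteDimensional ℝ (V r) := fun r =>
    ContinuousLinearMap.finite_dimensional_eigenspace hT _ (hR0 r)
  have hdim : Module.finrank ℝ (∀ r, V r) < Module.finrank ℝ (Fin (m + 1) → ℝ) := by
    rw [Module.finrank_pi_fintype, Module.finrank_fin_fun, Nat.lt_succ_iff]
    calc ∑ r : R, Module.finrank ℝ (V r)
        = ∑ r : R, ((Finset.range m).filter (σ · = (r : ℝ))).card := by
          refine Finset.sum_congr rfl fun r _ => ?_
          rw [← (hσ.ncard_eq hT (hR0 r)).2, ← Set.ncard_coe_finset]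
          congr 1
          ext i
          simp only [Set.mem_ofPred_eq, Finset.coe_filter, Finset.mem_range, iff_and_self]
          intro hi
          by_contra! hmi
          have := hσ.antitone hmi
          have := (Finset.mem_filter.1 r.2).2
          linarith
      _ = ∑ r ∈ R, ((Finset.range m).filter (σ · = r)).card :=
          Finset.sum_coe_sort R fun r => ((Finset.range m).filter (σ · = r)).card
      _ ≤ ∑ r ∈ (Finset.range m).image σ, ((Finset.range m).filter (σ · = r)).card :=
          Finset.sum_le_sum_of_subset (Finset.filter_subset _ _)
      _ = m := by
          rw [← Finset.card_eq_sum_card_image, Finset.card_range]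
  let L : (Fin (m + 1) → ℝ) →ₗ[ℝ] ∀ r, V r := LinearMap.pi fun r =>
    ((V r).orthogonalProjectionOnto : H →ₗ[ℝ] V r) ∘ₗ Fintype.linearCombination ℝ e
  obtain ⟨a, haL, ha0⟩ := (Submodule.ne_bot_iff _).1 (L.ker_ne_bot_of_finrank_lt hdim)
  set f : H := ∑ i, a i • e i with hf
  have hf0 : f ≠ 0 := fun h0 => ha0 (funext (Fintype.linearIndependent_iff.1 he a h0))
  let K : Submodule ℝ H := ⨅ r, (V r)ᗮ
  have hfK : f ∈ K := by
    refine Submodule.mem_iInf _ |>.2 fun r => ?_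
    rw [← Submodule.orthogonalProjectionOnto_eq_zero_iff]
    exact congrFun (LinearMap.mem_ker.1 haL) r
  have hinv : ∀ v ∈ K, T v ∈ K := fun v hv => Submodule.mem_iInf _ |>.2 fun r =>
    hs.invariant_orthogonalComplement_eigenspace r v (Submodule.mem_iInf _ |>.1 hv r)
  have hKc : IsClosed (K : Set H) := by
    rw [Submodule.coe_iInf]
    exact isClosed_iInter fun r => Submodule.isClosed_orthogonal _
  have : CompleteSpace K := hKc.completeSpace_coe
  let S : K →L[ℝ] K := T.restrict hinv
  have hS : IsCompactOperator S := hT.restrict' hinv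
  have hSs : S.IsSymmetric := hs.restrict_invariant hinv
  have hSn : ‖S‖ < c := by
    rcases eq_or_ne S 0 with h0 | h0
    · exact (S.opNorm_le_bound le_rfl fun x => by simp [h0]).trans_lt hc
    obtain ⟨r, hr, hev⟩ := exists_hasEigenvalue_abs_eq_norm hS hSs h0
    obtain ⟨v, hv⟩ := hev.exists_hasEigenvector
    have hTv : T v = r • (v : H) := congrArg Subtype.val hv.apply_eq_smul
    have hv0 : (v : H) ≠ 0 := fun h => hv.2 (Subtype.ext h)
    have hr0 : 0 ≤ r := by
      have := hpos v
      rw [hTv, inner_smul_left, real_inner_self_eq_norm_sq] at this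
      exact nonneg_of_mul_nonneg_left this (by positivity)
    rw [← hr, abs_of_nonneg hr0]
    by_contra! hcr
    have hvr : (v : H) ∈ Module.End.eigenspace (T : H →ₗ[ℝ] H) r :=
      Module.End.mem_eigenspace_iff.2 hTv
    have hrn : r ≠ 0 := (hc.trans_le hcr).ne'
    have hfr : FiniteDimensional ℝ (Module.End.eigenspace (T : H →ₗ[ℝ] H) r) :=
      ContinuousLinearMap.finite_dimensional_eigenspace hT r hrn
    have hne : {i | σ i = r}.Nonempty := by
      rw [← Set.ncard_pos (hσ.ncard_eq hT hrn).1, (hσ.ncard_eq hT hrn).2, Module.finrank_pos_iff]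
      exact ⟨⟨⟨v, hvr⟩, 0, fun h => hv0 (congrArg Subtype.val h)⟩⟩
    obtain ⟨i, hi : σ i = r⟩ := hne
    have him : i < m := by
      by_contra! hmi
      have := hσ.antitone hmi
      linarith
    have hrR : r ∈ R :=
      Finset.mem_filter.2 ⟨Finset.mem_image.2 ⟨i, Finset.mem_range.2 him, hi⟩, hcr⟩
    have hvo : (v : H) ∈ (Module.End.eigenspace (T : H →ₗ[ℝ] H) r)ᗮ :=
      Submodule.mem_iInf _ |>.1 v.2 ⟨r, hrR⟩
    exact hv0 (inner_self_eq_zero.1 ((Submodule.mem_orthogonal _ _).1 hvo _ hvr))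
  have h1 : inner ℝ (T f) f ≤ ‖S‖ * ‖f‖ ^ 2 := by
    calc inner ℝ (T f) f ≤ ‖T f‖ * ‖f‖ := real_inner_le_norm _ _
      _ = ‖S ⟨f, hfK⟩‖ * ‖f‖ := rfl
      _ ≤ ‖S‖ * ‖(⟨f, hfK⟩ : K)‖ * ‖f‖ := by gcongr; exact S.le_opNorm _
      _ = ‖S‖ * ‖f‖ ^ 2 := by rw [Submodule.coe_norm]; ring
  have h2 : ‖S‖ * ‖f‖ ^ 2 < c * ‖f‖ ^ 2 := by
    have : 0 < ‖f‖ := norm_pos_iff.2 hf0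
    gcongr
  linarith [h a]

/-- Partial sums of the eigenvalue sequence are bounded by any bound for the sum of the eigenvalues
along finite orthonormal systems of eigenvectors. -/
theorem IsEigenvalueSeq.sum_range_le (hσ : IsEigenvalueSeq T σ)
    (hT : IsCompactOperator T) (hs : T.IsSymmetric) (C : ℝ)
    (h : ∀ (ι : Type) [Fintype ι] (e : ι → H) (r : ι → ℝ), Orthonormal ℝ e → (∀ i, 0 < r i) →
      (∀ i, T (e i) = r i • e i) → ∑ i, r i ≤ C) (n : ℕ) :
    ∑ i ∈ Finset.range n, σ i ≤ C := by
  classical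
  set R : Finset ℝ := ((Finset.range n).image σ).filter (0 < ·) with hR
  have hRpos : ∀ r : R, 0 < (r : ℝ) := fun r => (Finset.mem_filter.1 r.2).2
  let V : R → Submodule ℝ H := fun r => Module.End.eigenspace (T : H →ₗ[ℝ] H) r
  have hVfin : ∀ r, FiniteDimensional ℝ (V r) := fun r =>
    ContinuousLinearMap.finite_dimensional_eigenspace hT _ (hRpos r).ne'
  have hV : OrthogonalFamily ℝ (fun r => V r) fun r => (V r).subtypeₗᵢ :=
    hs.orthogonalFamily_eigenspaces.comp Subtype.val_injective
  let b : ∀ r : R, OrthonormalBasis (Fin (Module.finrank ℝ (V r))) ℝ (V r) := fun r =>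
    stdOrthonormalBasis ℝ (V r)
  have hb := hV.orthonormal_sigma_orthonormal fun r => (b r).orthonormal
  have hle := h _ _ (fun a : Σ r : R, Fin (Module.finrank ℝ (V r)) => (a.1 : ℝ)) hb
    (fun a => hRpos a.1) (fun a => Module.End.mem_eigenspace_iff.1 (b a.1 a.2).2)
  refine le_trans ?_ hle
  rw [Fintype.sum_sigma]
  simp only [Finset.sum_const, Finset.card_univ, Fintype.card_fin]
  calc ∑ i ∈ Finset.range n, σ i
      = ∑ i ∈ (Finset.range n).filter (σ · ∈ R), σ i := by
        refine (Finset.sum_filter_of_ne fun i hi hne => ?_).symm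
        exact Finset.mem_filter.2 ⟨Finset.mem_image_of_mem _ hi, (hσ.nonneg i).lt_of_ne' hne⟩
    _ = ∑ r ∈ R, ∑ i ∈ ((Finset.range n).filter (σ · ∈ R)).filter (σ · = r), σ i :=
        (Finset.sum_fiberwise_of_maps_to (fun i hi => (Finset.mem_filter.1 hi).2) _).symm
    _ = ∑ r : R, ∑ i ∈ ((Finset.range n).filter (σ · ∈ R)).filter (σ · = (r : ℝ)), σ i :=
        (Finset.sum_coe_sort R fun r =>
          ∑ i ∈ ((Finset.range n).filter (σ · ∈ R)).filter (σ · = r), σ i).symm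
    _ ≤ _ := Finset.sum_le_sum fun r _ => ?_
  rw [Finset.sum_congr rfl fun i hi => (Finset.mem_filter.1 hi).2, Finset.sum_const, nsmul_eq_mul,
    nsmul_eq_mul, ← (hσ.ncard_eq hT (hRpos r).ne').2]
  have := (hRpos r).le
  gcongr
  rw [← Set.ncard_coe_finset]
  exact Set.ncard_le_ncard (fun i hi => (Finset.mem_filter.1 hi).2) (hσ.ncard_eq hT (hRpos r).ne').1

end Compact

namespace IsIntegrableKernel

/-! ### The integral operator of a positive semi-definite kernel -/

variable {E : Type*} [MeasurableSpace E] {k : E → E → ℝ} {μ : Measure E}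

theorem symm (hk : IsIntegrableKernel k μ) (x y : E) : k x y = k y x := by
  simpa using hk.posSemidef.isHermitian.apply y x

theorem sum_nonneg (hk : IsIntegrableKernel k μ) {ι : Type*} [Fintype ι] (x : ι → E) (c : ι → ℝ) :
    0 ≤ ∑ a, ∑ b, k (x a) (x b) * c b * c a := by
  have h := (hk.posSemidef.submatrix x).dotProduct_mulVec_nonneg c
  simp only [dotProduct, Matrix.mulVec, Matrix.submatrix_apply, Matrix.of_apply, Pi.star_apply,
    star_trivial, Finset.mul_sum] at h
  refine h.trans_eq (Finset.sum_congr rfl fun a _ => Finset.sum_congr rfl fun b _ => ?_)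
  ring

theorem measurable_right (hk : IsIntegrableKernel k μ) (x : E) : Measurable (k x) :=
  hk.measurable.comp measurable_prodMk_left

theorem measurable_diag (hk : IsIntegrableKernel k μ) : Measurable fun x => k x x :=
  hk.measurable.comp (measurable_id.prodMk measurable_id)

theorem memLp_right (hk : IsIntegrableKernel k μ) (x : E) : MemLp (k x) 2 μ := by
  refine hk.memLp_sqrt_diag.of_le_mul (c := √(k x x)) (hk.measurable_right x).aestronglyMeasurable
    (ae_of_all _ fun y => ?_)
  rw [Real.norm_eq_abs, Real.norm_of_nonneg (Real.sqrt_nonneg _)]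
  exact hk.abs_le x y

theorem integrable_prod [SFinite μ] (hk : IsIntegrableKernel k μ) (f g : Lp ℝ 2 μ) :
    Integrable (fun p : E × E => k p.1 p.2 * f p.2 * g p.1) (μ.prod μ) := by
  refine ((hk.integrable_sqrt_mul g).mul_prod (hk.integrable_sqrt_mul f)).mono' ?_
    (ae_of_all _ fun p => ?_)
  · exact (hk.measurable.aestronglyMeasurable.mul
      ((Lp.stronglyMeasurable f).comp_measurable measurable_snd).aestronglyMeasurable).mul
      ((Lp.stronglyMeasurable g).comp_measurable measurable_fst).aestronglyMeasurable
  · rw [norm_mul, norm_mul, Real.norm_eq_abs, Real.norm_eq_abs, Real.norm_eq_abs]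
    calc |k p.1 p.2| * |f p.2| * |g p.1|
        ≤ √(k p.1 p.1) * √(k p.2 p.2) * |f p.2| * |g p.1| := by
          gcongr
          exact hk.abs_le _ _
      _ = _ := by ring

theorem inner_integralOperator [SFinite μ] (hk : IsIntegrableKernel k μ) (f g : Lp ℝ 2 μ) :
    inner ℝ (hk.integralOperator f) g = ∫ x, (∫ y, k x y * f y ∂μ) * g x ∂μ := by
  rw [L2.inner_def]
  refine integral_congr_ae ?_
  filter_upwards [hk.integralOperator_ae f] with x hx
  rw [hx]
  simp [mul_comm]

theorem inner_integralOperator_prod [SFinite μ] (hk : IsIntegrableKernel k μ) (f g : Lp ℝ 2 μ) :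
    inner ℝ (hk.integralOperator f) g =
      ∫ p : E × E, k p.1 p.2 * f p.2 * g p.1 ∂(μ.prod μ) := by
  rw [inner_integralOperator, MeasureTheory.integral_prod _ (hk.integrable_prod f g)]
  simp only [integral_mul_const]

theorem isSymmetric_integralOperator [SFinite μ] (hk : IsIntegrableKernel k μ) :
    hk.integralOperator.IsSymmetric := by
  intro f g
  change inner ℝ (hk.integralOperator f) g = inner ℝ f (hk.integralOperator g)
  rw [real_inner_comm (hk.integralOperator g), inner_integralOperator_prod,
    inner_integralOperator_prod, ← integral_prod_swap]
  refine integral_congr_ae (ae_of_all _ fun p => ?_)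
  simp only [Prod.fst_swap, Prod.snd_swap]
  rw [hk.symm]
  ring

theorem measurePreserving_eval_prodMk [IsProbabilityMeasure μ] {n : ℕ} {a b : Fin n}
    (hab : a ≠ b) : MeasurePreserving (fun x : Fin n → E => (x a, x b))
      (Measure.pi fun _ => μ) (μ.prod μ) := by
  have hind : iIndepFun (fun (i : Fin n) (x : Fin n → E) => x i) (Measure.pi fun _ => μ) :=
    iIndepFun_pi (X := fun _ => id) fun _ => aemeasurable_id
  have hm : ∀ i : Fin n, Measurable fun x : Fin n → E => x i := fun i => measurable_pi_apply i
  refine ⟨(hm a).prodMk (hm b), ?_⟩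
  rw [(indepFun_iff_map_prod_eq_prod_map_map (hm a).aemeasurable (hm b).aemeasurable).1
    (hind.indepFun hab), (measurePreserving_eval (fun _ => μ) a).map_eq,
    (measurePreserving_eval (fun _ => μ) b).map_eq]

/-- The quadratic form of the kernel is nonnegative on bounded functions: average the
nonnegative quadratic forms of the kernel over `n` independent points and let `n` grow. -/
theorem integral_prod_nonneg [IsProbabilityMeasure μ] (hk : IsIntegrableKernel k μ) {f : E → ℝ}
    (hf : Measurable f) {C : ℝ} (hC : ∀ x, |f x| ≤ C)
    (hint : Integrable (fun p : E × E => k p.1 p.2 * f p.2 * f p.1) (μ.prod μ)) :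
    0 ≤ ∫ p : E × E, k p.1 p.2 * f p.2 * f p.1 ∂(μ.prod μ) := by
  set I := ∫ p : E × E, k p.1 p.2 * f p.2 * f p.1 ∂(μ.prod μ) with hI
  set J := ∫ x, k x x * f x * f x ∂μ with hJ
  have hJint : Integrable (fun x => k x x * f x * f x) μ := by
    refine (hk.integrable_diag.mul_const (C * C)).mono'
      ((hk.measurable_diag.mul hf).mul hf).aestronglyMeasurable (ae_of_all _ fun x => ?_)
    rw [norm_mul, norm_mul, Real.norm_eq_abs, Real.norm_eq_abs, abs_of_nonneg (hk.diag_nonneg x),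
      mul_assoc]
    have := hk.diag_nonneg x
    have := abs_nonneg (f x)
    gcongr
    · exact this.trans (hC x)
    · exact hC x
    · exact hC x
  have hterm : ∀ (n : ℕ) (a b : Fin n),
      Integrable (fun x : Fin n → E => k (x a) (x b) * f (x b) * f (x a)) (Measure.pi fun _ => μ) ∧
      ∫ x : Fin n → E, k (x a) (x b) * f (x b) * f (x a) ∂(Measure.pi fun _ => μ) =
        if a = b then J else I := by
    intro n a b
    split_ifs with hab
    · subst hab
      have hmp := measurePreserving_eval (fun _ : Fin n => μ) a
      refine ⟨hmp.integrable_comp_of_integrable hJint, ?_⟩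
      rw [hJ]
      nth_rewrite 2 [← hmp.map_eq]
      rw [integral_map hmp.measurable.aemeasurable]
      rw [hmp.map_eq]
      exact hJint.aestronglyMeasurable
    · have hmp := measurePreserving_eval_prodMk (μ := μ) hab
      refine ⟨hmp.integrable_comp_of_integrable hint, ?_⟩
      rw [hI, ← hmp.map_eq, integral_map hmp.measurable.aemeasurable]
      rw [hmp.map_eq]
      exact hint.aestronglyMeasurable
  have hn : ∀ n : ℕ, 0 ≤ (n : ℝ) * J + ((n : ℝ) * n - n) * I := by
    intro n
    have h0 : 0 ≤ ∫ x : Fin n → E, ∑ a, ∑ b, k (x a) (x b) * f (x b) * f (x a)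
        ∂(Measure.pi fun _ => μ) :=
      integral_nonneg fun x => hk.sum_nonneg x fun a => f (x a)
    rw [integral_finsetSum _ fun a _ => integrable_finsetSum _ fun b _ => (hterm n a b).1] at h0
    simp_rw [integral_finsetSum _ fun b _ => (hterm n _ b).1, (hterm n _ _).2] at h0
    refine h0.trans_eq ?_
    have : ∀ a b : Fin n, (if a = b then J else I) = I + if a = b then J - I else 0 := by
      intro a b
      split_ifs <;> ring
    simp only [this, Finset.sum_add_distrib, Finset.sum_const, Finset.card_univ, Fintype.card_fin,
      Finset.sum_ite_eq, Finset.mem_univ, if_true, nsmul_eq_mul]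
    ring
  by_contra! hneg
  obtain ⟨n, hn'⟩ := exists_nat_gt (J / (-I))
  rw [div_lt_iff₀ (by linarith)] at hn'
  have h1 := hn (n + 1)
  push_cast at h1
  have h2 : ((n : ℝ) + 1) * (J - n * (-I)) < 0 :=
    mul_neg_of_pos_of_neg (by positivity) (by linarith)
  nlinarith

theorem inner_integralOperator_self_nonneg [IsProbabilityMeasure μ] (hk : IsIntegrableKernel k μ)
    (f : Lp ℝ 2 μ) : 0 ≤ inner ℝ (hk.integralOperator f) f := by
  have hclosed : IsClosed {f : Lp ℝ 2 μ | 0 ≤ inner ℝ (hk.integralOperator f) f} :=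
    isClosed_le continuous_const (hk.integralOperator.continuous.inner continuous_id)
  refine (Lp.simpleFunc.denseRange (E := ℝ) (μ := μ) (p := 2) (by simp)).induction_on
    (p := fun f : Lp ℝ 2 μ => 0 ≤ inner ℝ (hk.integralOperator f) f) f hclosed fun g => ?_
  have hg := Lp.simpleFunc.toSimpleFunc_eq_toFun g
  set G := Lp.simpleFunc.toSimpleFunc g
  have hae : (fun p : E × E => k p.1 p.2 * (g : Lp ℝ 2 μ) p.2 * (g : Lp ℝ 2 μ) p.1)
      =ᵐ[μ.prod μ] fun p => k p.1 p.2 * G p.2 * G p.1 := by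
    filter_upwards [Measure.quasiMeasurePreserving_fst.ae_eq_comp hg,
      Measure.quasiMeasurePreserving_snd.ae_eq_comp hg] with p h1 h2
    simp only [Function.comp_apply] at h1 h2
    rw [h1, h2]
  obtain ⟨C, hC⟩ := G.exists_forall_norm_le
  rw [inner_integralOperator_prod, integral_congr_ae hae]
  exact hk.integral_prod_nonneg G.measurable hC ((hk.integrable_prod _ _).congr hae)

theorem inner_toLp_right (hk : IsIntegrableKernel k μ) (x : E) (f : Lp ℝ 2 μ) :
    inner ℝ f (hk.memLp_right x).toLp = ∫ y, k x y * f y ∂μ := by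
  rw [L2.inner_def]
  refine integral_congr_ae ?_
  filter_upwards [(hk.memLp_right x).coeFn_toLp] with y hy
  rw [hy]
  simp

theorem norm_toLp_right_sq_le (hk : IsIntegrableKernel k μ) (x : E) :
    ‖(hk.memLp_right x).toLp‖ ^ 2 ≤ k x x * ∫ y, k y y ∂μ := by
  rw [← real_inner_self_eq_norm_sq, hk.inner_toLp_right, ← integral_const_mul]
  have hae : (fun y => k x y * (hk.memLp_right x).toLp (k x) y) =ᵐ[μ] fun y => k x y * k x y := by
    filter_upwards [(hk.memLp_right x).coeFn_toLp] with y hy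
    rw [hy]
  rw [integral_congr_ae hae]
  refine integral_mono ((hk.memLp_right x).integrable_mul (hk.memLp_right x))
    (hk.integrable_diag.const_mul _) fun y => ?_
  have h := hk.abs_le x y
  have := mul_self_le_mul_self (abs_nonneg _) h
  rw [abs_mul_abs_self] at this
  refine this.trans_eq ?_
  have h1 := Real.mul_self_sqrt (hk.diag_nonneg x)
  have h2 := Real.mul_self_sqrt (hk.diag_nonneg y)
  calc _ = (√(k x x) * √(k x x)) * (√(k y y) * √(k y y)) := by ring
    _ = _ := by rw [h1, h2]

theorem isCompactOperator_integralOperator [SFinite μ] (hk : IsIntegrableKernel k μ) :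
    IsCompactOperator hk.integralOperator := by
  refine isCompactOperator_of_sum_norm_sq_le _ ((∫ y, k y y ∂μ) * ∫ y, k y y ∂μ) fun n e he => ?_
  have h1 : ∀ i, ‖hk.integralOperator (e i)‖ ^ 2 = ∫ x, (∫ y, k x y * e i y ∂μ) ^ 2 ∂μ := by
    intro i
    rw [← real_inner_self_eq_norm_sq, L2.inner_def]
    refine integral_congr_ae ?_
    filter_upwards [hk.integralOperator_ae (e i)] with x hx
    rw [hx]
    simp [sq]
  have h2 : ∀ i, Integrable (fun x => (∫ y, k x y * e i y ∂μ) ^ 2) μ := fun i =>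
    (hk.memLp_integral (e i)).integrable_sq
  simp only [h1]
  rw [← integral_finsetSum _ fun i _ => h2 i, ← integral_mul_const]
  refine integral_mono (integrable_finsetSum _ fun i _ => h2 i)
    (hk.integrable_diag.mul_const _) fun x => ?_
  refine le_trans (le_of_eq ?_) ((he.sum_inner_products_le _ (s := Finset.univ)).trans
    (hk.norm_toLp_right_sq_le x))
  refine Finset.sum_congr rfl fun i _ => ?_
  rw [hk.inner_toLp_right, Real.norm_eq_abs, sq_abs]

end IsIntegrableKernel

theorem transpose_pinv_of_isHermitian {n : Type*} [Fintype n] {S : Matrix n n ℝ}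
    (hS : S.IsHermitian) : (pinv S)ᵀ = pinv S := by
  obtain ⟨T, hT, h⟩ := exists_isMoorePenrose_of_symm S hS
  rw [(pinv_spec S).unique h, hT]

theorem posSemidef_pinv {n : Type*} [Fintype n] {S : Matrix n n ℝ} (hS : S.PosSemidef) :
    (pinv S).PosSemidef := by
  have h := hS.mul_mul_conjTranspose_same (pinv S)
  rwa [Matrix.conjTranspose_eq_transpose_of_trivial, transpose_pinv_of_isHermitian hS.isHermitian,
    (pinv_spec S).self_mul_mul] at h

namespace IsIntegrableKernel

/-! ### Nyström kernels are dominated by the kernel -/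

variable {E : Type*} [MeasurableSpace E] {k : E → E → ℝ} {μ : Measure E} {l : ℕ}

theorem posSemidef_gram (hk : IsIntegrableKernel k μ) (Z : Fin l → E) : (gram k Z).PosSemidef :=
  hk.posSemidef.submatrix Z

theorem nystromKernel_eq (hk : IsIntegrableKernel k μ) (Z : Fin l → E) (x y : E) :
    nystromKernel k Z x y = kvec k Z x ⬝ᵥ pinv (gram k Z) *ᵥ kvec k Z y := by
  rw [nystromKernel, show (fun i => k x (Z i)) = kvec k Z x from funext fun i => hk.symm _ _]

theorem nystromKernel_symm (hk : IsIntegrableKernel k μ) (Z : Fin l → E) (x y : E) :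
    nystromKernel k Z x y = nystromKernel k Z y x := by
  rw [hk.nystromKernel_eq, hk.nystromKernel_eq, Matrix.dotProduct_mulVec, ← Matrix.mulVec_transpose,
    transpose_pinv_of_isHermitian (hk.posSemidef_gram Z).isHermitian, dotProduct_comm]

theorem sum_nystromKernel_le (hk : IsIntegrableKernel k μ) (Z : Fin l → E) {ι : Type*} [Fintype ι]
    (x : ι → E) (c : ι → ℝ) :
    ∑ i, ∑ j, nystromKernel k Z (x i) (x j) * c j * c i ≤ ∑ i, ∑ j, k (x i) (x j) * c j * c i := by
  set G := gram k Z with hG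
  set Q := pinv G with hQ
  have hQt : Qᵀ = Q := transpose_pinv_of_isHermitian (hk.posSemidef_gram Z).isHermitian
  set b : Fin l → ℝ := ∑ i, c i • kvec k Z (x i) with hb
  set a : Fin l → ℝ := Q *ᵥ b with ha
  have hba : ∀ p, b p = ∑ i, k (Z p) (x i) * c i := fun p => by
    simp [hb, Finset.sum_apply, kvec, mul_comm]
  have e1 : ∑ i, ∑ j, nystromKernel k Z (x i) (x j) * c j * c i = b ⬝ᵥ a := by
    rw [ha, hb, sum_dotProduct]
    refine Finset.sum_congr rfl fun i _ => ?_
    rw [Matrix.mulVec_sum, dotProduct_sum]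
    refine Finset.sum_congr rfl fun j _ => ?_
    rw [hk.nystromKernel_eq, smul_dotProduct, Matrix.mulVec_smul, dotProduct_smul, smul_eq_mul,
      smul_eq_mul]
    ring
  have e2 : ∑ p, ∑ q, k (Z p) (Z q) * a q * a p = b ⬝ᵥ a := by
    have : ∑ p, ∑ q, k (Z p) (Z q) * a q * a p = a ⬝ᵥ G *ᵥ a := by
      simp only [dotProduct, Matrix.mulVec, Finset.mul_sum, hG, gram, Matrix.of_apply]
      exact Finset.sum_congr rfl fun p _ => Finset.sum_congr rfl fun q _ => by ring
    rw [this, ha, Matrix.mulVec_mulVec, Matrix.dotProduct_mulVec, ← Matrix.mulVec_transpose,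
      Matrix.transpose_mul, hQt, (show Gᵀ = G from (hk.posSemidef_gram Z).isHermitian),
      Matrix.mulVec_mulVec, (pinv_spec G).self_mul_mul, dotProduct_comm]
  have e3 : ∑ p, ∑ j, k (Z p) (x j) * c j * a p = b ⬝ᵥ a := by
    simp only [dotProduct, hba, Finset.sum_mul]
  have e4 : ∑ i, ∑ q, k (x i) (Z q) * a q * c i = b ⬝ᵥ a := by
    rw [← e3, Finset.sum_comm]
    refine Finset.sum_congr rfl fun p _ => Finset.sum_congr rfl fun j _ => ?_
    rw [hk.symm]
    ring
  have h := hk.sum_nonneg (Sum.elim Z x) (Sum.elim (fun p => -a p) c)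
  simp only [Fintype.sum_sum_type, Sum.elim_inl, Sum.elim_inr, Finset.sum_add_distrib, mul_neg,
    neg_mul, Finset.sum_neg_distrib, e2, e3, e4] at h
  rw [e1]
  linarith

theorem measurable_nystromKernel (hk : IsIntegrableKernel k μ) (Z : Fin l → E) :
    Measurable (Function.uncurry (nystromKernel k Z)) := by
  have h : Function.uncurry (nystromKernel k Z) = fun p : E × E =>
      ∑ a, kvec k Z p.1 a * ∑ b, pinv (gram k Z) a b * kvec k Z p.2 b := by
    ext p
    exact hk.nystromKernel_eq Z p.1 p.2
  rw [h]
  exact Finset.measurable_sum _ fun a _ =>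
    ((measurable_kvec hk.measurable Z a).comp measurable_fst).mul
      (Finset.measurable_sum _ fun b _ =>
        ((measurable_kvec hk.measurable Z b).comp measurable_snd).const_mul _)

theorem nystromKernel_self_nonneg (hk : IsIntegrableKernel k μ) (Z : Fin l → E) (x : E) :
    0 ≤ nystromKernel k Z x x := by
  rw [hk.nystromKernel_eq]
  simpa using (posSemidef_pinv (hk.posSemidef_gram Z)).dotProduct_mulVec_nonneg (kvec k Z x)

theorem nystromKernel_self_le (hk : IsIntegrableKernel k μ) (Z : Fin l → E) (x : E) :
    nystromKernel k Z x x ≤ k x x := by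
  simpa using hk.sum_nystromKernel_le Z (fun _ : Unit => x) fun _ => 1

/-- The residual `k - k^Z` is again a positive semi-definite kernel. -/
theorem sub_nystromKernel (hk : IsIntegrableKernel k μ) (Z : Fin l → E) :
    IsIntegrableKernel (fun x y => k x y - nystromKernel k Z x y) μ where
  posSemidef := by
    refine ⟨Matrix.IsHermitian.ext fun x y => ?_, fun c => ?_⟩
    · simp only [Matrix.of_apply, star_trivial]
      rw [hk.symm, hk.nystromKernel_symm]
    · have h := hk.sum_nystromKernel_le Z (fun x : c.support => (x : E)) fun x => c x
      rw [← sub_nonneg, ← Finset.sum_sub_distrib] at h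
      simp only [Finsupp.sum]
      rw [← Finset.sum_coe_sort c.support]
      refine h.trans_eq (Finset.sum_congr rfl fun i _ => ?_)
      rw [← Finset.sum_coe_sort c.support, ← Finset.sum_sub_distrib]
      refine Finset.sum_congr rfl fun j _ => ?_
      simp only [star_trivial, Matrix.of_apply]
      ring
  measurable := hk.measurable.sub (hk.measurable_nystromKernel Z)
  integrable_diag := by
    refine hk.integrable_diag.mono' ?_ (ae_of_all _ fun x => ?_)
    · exact (hk.measurable_diag.sub ((hk.measurable_nystromKernel Z).comp
        (measurable_id.prodMk measurable_id))).aestronglyMeasurable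
    · rw [Real.norm_of_nonneg (sub_nonneg.2 (hk.nystromKernel_self_le Z x))]
      exact sub_le_self _ (hk.nystromKernel_self_nonneg Z x)

theorem quadForm_le_inner_integralOperator [IsProbabilityMeasure μ] (hk : IsIntegrableKernel k μ)
    (Z : Fin l → E) (f : Lp ℝ 2 μ) :
    (fun a => ∫ y, k (Z a) y * f y ∂μ) ⬝ᵥ pinv (gram k Z) *ᵥ (fun a => ∫ y, k (Z a) y * f y ∂μ) ≤
      inner ℝ (hk.integralOperator f) f := by
  set w : Fin l → ℝ := fun a => ∫ y, k (Z a) y * f y ∂μ with hw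
  have h := (hk.sub_nystromKernel Z).inner_integralOperator_self_nonneg f
  have e1 : ∀ x, ∫ y, (k x y - nystromKernel k Z x y) * f y ∂μ =
      (∫ y, k x y * f y ∂μ) - kvec k Z x ⬝ᵥ pinv (gram k Z) *ᵥ w := by
    intro x
    have e : ∀ y, (k x y - nystromKernel k Z x y) * f y = k x y * f y -
        ∑ b, (kvec k Z x ᵥ* pinv (gram k Z)) b * (k (Z b) y * f y) := by
      intro y
      rw [hk.nystromKernel_eq, Matrix.dotProduct_mulVec, sub_mul, dotProduct, Finset.sum_mul]
      congr 1
      exact Finset.sum_congr rfl fun b _ => by rw [mul_assoc, kvec]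
    simp only [e]
    rw [integral_sub (hk.integrable_mul f x)
      (integrable_finsetSum _ fun b _ => (hk.integrable_mul f (Z b)).const_mul _),
      integral_finsetSum _ fun b _ => (hk.integrable_mul f (Z b)).const_mul _,
      Matrix.dotProduct_mulVec]
    simp only [integral_const_mul]
    rfl
  have hint : Integrable (fun x => (∫ y, k x y * f y ∂μ) * f x) μ :=
    (hk.memLp_integral f).integrable_mul (Lp.memLp f)
  have e2 : ∀ x, (∫ y, (k x y - nystromKernel k Z x y) * f y ∂μ) * f x =
      (∫ y, k x y * f y ∂μ) * f x - ∑ a, (pinv (gram k Z) *ᵥ w) a * (k (Z a) x * f x) := by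
    intro x
    rw [e1, sub_mul, dotProduct, Finset.sum_mul]
    congr 1
    exact Finset.sum_congr rfl fun a _ => by rw [kvec]; ring
  rw [inner_integralOperator] at h
  simp only [e2] at h
  rw [integral_sub hint
      (integrable_finsetSum _ fun b _ => (hk.integrable_mul f (Z b)).const_mul _),
      integral_finsetSum _ fun b _ => (hk.integrable_mul f (Z b)).const_mul _] at h
  simp only [integral_const_mul] at h
  rw [hk.inner_integralOperator, dotProduct_comm]
  exact sub_nonneg.1 h

theorem sq_integral_le [IsProbabilityMeasure μ] (hk : IsIntegrableKernel k μ) (x : E)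
    (f : Lp ℝ 2 μ) :
    (∫ y, k x y * f y ∂μ) ^ 2 ≤ k x x * inner ℝ (hk.integralOperator f) f := by
  rcases (hk.diag_nonneg x).eq_or_lt with h0 | h0
  · have : ∀ y, k x y = 0 := fun y => by
      have h := hk.abs_le x y
      rw [← h0, Real.sqrt_zero, zero_mul] at h
      exact abs_nonpos_iff.1 h
    simp [this]
  · have h := hk.quadForm_le_inner_integralOperator (fun _ : Fin 1 => x) f
    have hp := congrFun (congrFun (pinv_spec (gram k fun _ : Fin 1 => x)).mul_mul_self 0) 0
    simp only [Matrix.mul_apply, Finset.univ_unique, Fin.default_eq_zero, Finset.sum_singleton,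
      gram, Matrix.of_apply] at hp
    simp only [dotProduct, Matrix.mulVec, Finset.univ_unique, Fin.default_eq_zero,
      Finset.sum_singleton] at h
    change _ * (pinv (Matrix.of fun _ _ => k x x) 0 0 * _) ≤ _ at h
    have hp' : k x x * pinv (Matrix.of fun _ _ : Fin 1 => k x x) 0 0 = 1 :=
      mul_right_cancel₀ h0.ne' (by rw [hp, one_mul])
    calc _ = k x x * ((∫ y, k x y * f y ∂μ) * (pinv (Matrix.of fun _ _ : Fin 1 => k x x) 0 0 *
          ∫ y, k x y * f y ∂μ)) := by linear_combination (-(∫ y, k x y * f y ∂μ) ^ 2) * hp'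
      _ ≤ _ := mul_le_mul_of_nonneg_left h h0.le

/-- The trace inequality `∑ᵢ rᵢ ≤ ∫ k(x, x) dμ(x)` along orthonormal systems of eigenfunctions. -/
theorem sum_eigenvalues_le [IsProbabilityMeasure μ] (hk : IsIntegrableKernel k μ)
    {ι : Type*} [Fintype ι] (e : ι → Lp ℝ 2 μ) (r : ι → ℝ) (he : Orthonormal ℝ e)
    (hr : ∀ i, 0 < r i) (hK : ∀ i, hk.integralOperator (e i) = r i • e i) :
    ∑ i, r i ≤ ∫ x, k x x ∂μ := by
  classical
  set u : ι → E → ℝ := fun i x => ∫ y, k x y * e i y ∂μ with hu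
  have hpt : ∀ x, ∑ i, (r i)⁻¹ * u i x ^ 2 ≤ k x x := by
    intro x
    set q := ∑ i, (r i)⁻¹ * u i x ^ 2 with hq
    set f : Lp ℝ 2 μ := ∑ i, ((r i)⁻¹ * u i x) • e i with hf
    have h1 : ∫ y, k x y * f y ∂μ = q := by
      rw [← hk.inner_toLp_right, hf, sum_inner, hq]
      refine Finset.sum_congr rfl fun i _ => ?_
      rw [real_inner_smul_left, hk.inner_toLp_right]
      ring
    have h2 : inner ℝ (hk.integralOperator f) f = q := by
      have : hk.integralOperator f = ∑ i, u i x • e i := by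
        rw [hf, map_sum]
        refine Finset.sum_congr rfl fun i _ => ?_
        rw [map_smul, hK, smul_smul]
        congr 1
        field_simp [(hr i).ne']
      rw [this, hf, he.inner_sum, hq]
      refine Finset.sum_congr rfl fun i _ => ?_
      simp only [conj_trivial]
      ring
    have h3 := hk.sq_integral_le x f
    rw [h1, h2] at h3
    have hq0 : 0 ≤ q := Finset.sum_nonneg fun i _ =>
      mul_nonneg (inv_nonneg.2 (hr i).le) (sq_nonneg _)
    rcases hq0.eq_or_lt with h0 | h0
    · rw [← h0]
      exact hk.diag_nonneg x
    · rw [sq] at h3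
      exact le_of_mul_le_mul_right h3 h0
  have hi : ∀ i, Integrable (fun x => (r i)⁻¹ * u i x ^ 2) μ := fun i =>
    (hk.memLp_integral (e i)).integrable_sq.const_mul _
  have hn : ∀ i, ∫ x, (r i)⁻¹ * u i x ^ 2 ∂μ = r i := by
    intro i
    have : ∫ x, u i x ^ 2 ∂μ = ‖hk.integralOperator (e i)‖ ^ 2 := by
      rw [← real_inner_self_eq_norm_sq, L2.inner_def]
      refine integral_congr_ae ?_
      filter_upwards [hk.integralOperator_ae (e i)] with x hx
      rw [hx]
      simp [hu, sq]
    rw [integral_const_mul, this, hK, norm_smul, he.1 i, mul_one, Real.norm_eq_abs, sq_abs]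
    field_simp [(hr i).ne']
  calc ∑ i, r i = ∫ x, ∑ i, (r i)⁻¹ * u i x ^ 2 ∂μ := by
        rw [integral_finsetSum _ fun i _ => hi i]
        exact Finset.sum_congr rfl fun i _ => (hn i).symm
    _ ≤ _ := integral_mono (integrable_finsetSum _ fun i _ => hi i) hk.integrable_diag hpt

theorem summable_eigenvalues [IsProbabilityMeasure μ] (hk : IsIntegrableKernel k μ) {σ : ℕ → ℝ}
    (hσ : IsEigenvalueSeq hk.integralOperator σ) : Summable σ :=
  summable_of_sum_range_le hσ.nonneg (hσ.sum_range_le hk.isCompactOperator_integralOperator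
    hk.isSymmetric_integralOperator _ fun _ _ => hk.sum_eigenvalues_le)

end IsIntegrableKernel

/-! ### Spectral features of the Nyström kernel and the expectation bound -/

open scoped MatrixOrder Matrix.Norms.L2Operator in
theorem exists_transpose_mul_self_eq {n : Type*} [Fintype n] {A : Matrix n n ℝ}
    (hA : A.PosSemidef) : ∃ B : Matrix n n ℝ, Bᵀ * B = A := by
  classical
  obtain ⟨B, hB⟩ := CStarAlgebra.nonneg_iff_eq_star_mul_self.1 hA.nonneg
  exact ⟨B, by rw [hB, Matrix.star_eq_conjTranspose, Matrix.conjTranspose_eq_transpose_of_trivial]⟩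

theorem MercerData.sum_tail_le {E : Type*} [MeasurableSpace E] {k : E → E → ℝ} {l : ℕ}
    {Z : Fin l → E} {ν : Measure E} (D : MercerData k Z ν) (s : ℕ)
    {B : Matrix (Fin l) (Fin l) ℝ} (hB : Bᵀ * B = pinv (gram k Z)) :
    ∑ i : Fin l, (if s ≤ (i : ℕ) then D.κ i else 0) ≤
      ∑ i : Fin l, if s ≤ (i : ℕ) then (B * gram (squareKernel k ν) Z * Bᵀ) i i else 0 := by
  obtain ⟨U, hU, h⟩ := D.exists_diagonalization hB
  rw [h]
  simpa using sum_tail_le_partial_trace hU (one_mem _) D.antitone s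

namespace IsIntegrableKernel

variable {E : Type*} [MeasurableSpace E] {k : E → E → ℝ} {μ : Measure E} {l : ℕ}

theorem inner_toLp_toLp (hk : IsIntegrableKernel k μ) (x y : E) :
    inner ℝ (hk.memLp_right x).toLp (hk.memLp_right y).toLp = squareKernel k μ x y := by
  rw [hk.inner_toLp_right, squareKernel]
  refine integral_congr_ae ?_
  filter_upwards [(hk.memLp_right x).coeFn_toLp] with t ht
  rw [ht, hk.symm t y, mul_comm]

theorem isHermitian_gram_squareKernel (hk : IsIntegrableKernel k μ) (Z : Fin l → E) :
    (gram (squareKernel k μ) Z).IsHermitian := by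
  refine Matrix.IsHermitian.ext fun a b => ?_
  simp only [gram, Matrix.of_apply, star_trivial, ← hk.inner_toLp_toLp]
  exact real_inner_comm _ _

theorem exists_spectral_features (hk : IsIntegrableKernel k μ) (Z : Fin l → E) :
    ∃ (B : Matrix (Fin l) (Fin l) ℝ) (d : Fin l → ℝ), Bᵀ * B = pinv (gram k Z) ∧ Antitone d ∧
      B * gram (squareKernel k μ) Z * Bᵀ = Matrix.diagonal d := by
  obtain ⟨A, hA⟩ := exists_transpose_mul_self_eq (posSemidef_pinv (hk.posSemidef_gram Z))
  obtain ⟨U, hU, d, hd, h⟩ := exists_antitone_diagonalization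
    (A * gram (squareKernel k μ) Z * Aᵀ) (by
      have := Matrix.isHermitian_mul_mul_conjTranspose A (hk.isHermitian_gram_squareKernel Z)
      rwa [Matrix.conjTranspose_eq_transpose_of_trivial] at this)
  have hU1 : U * Uᵀ = 1 := (Matrix.mem_orthogonalGroup_iff _ _).1 hU
  have hU2 : Uᵀ * U = 1 := (Matrix.mem_orthogonalGroup_iff' _ _).1 hU
  refine ⟨Uᵀ * A, d, ?_, hd, ?_⟩
  · rw [← hA, Matrix.transpose_mul, Matrix.transpose_transpose, Matrix.mul_assoc,
      ← Matrix.mul_assoc U, hU1, Matrix.one_mul]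
  · calc Uᵀ * A * gram (squareKernel k μ) Z * (Uᵀ * A)ᵀ
        = Uᵀ * (A * gram (squareKernel k μ) Z * Aᵀ) * U := by
          simp [Matrix.transpose_mul, Matrix.mul_assoc]
      _ = (Uᵀ * U) * Matrix.diagonal d * (Uᵀ * U) := by
          rw [h]
          simp only [Matrix.mul_assoc]
      _ = Matrix.diagonal d := by rw [hU2, Matrix.one_mul, Matrix.mul_one]

variable [IsProbabilityMeasure μ]

/-- The eigenvalues of the Nyström covariance matrix are dominated by those of the integral
operator. -/
theorem spectral_features_le (hk : IsIntegrableKernel k μ) {σ : ℕ → ℝ}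
    (hσ : IsEigenvalueSeq hk.integralOperator σ) (Z : Fin l → E)
    {B : Matrix (Fin l) (Fin l) ℝ} {d : Fin l → ℝ} (hB : Bᵀ * B = pinv (gram k Z))
    (hd : Antitone d) (h : B * gram (squareKernel k μ) Z * Bᵀ = Matrix.diagonal d) (i : Fin l) :
    d i ≤ σ i := by
  rcases le_or_gt (d i) 0 with h0 | h0
  · exact h0.trans (hσ.nonneg i)
  let φ : Fin l → Lp ℝ 2 μ := fun a => ∑ b, B a b • (hk.memLp_right (Z b)).toLp
  have hφ : ∀ a b, inner ℝ (φ a) (φ b) = if a = b then d a else 0 := by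
    intro a b
    have := congrFun (congrFun h a) b
    rw [Matrix.diagonal_apply] at this
    rw [← this]
    simp only [φ, sum_inner, inner_sum, real_inner_smul_left, real_inner_smul_right,
      hk.inner_toLp_toLp, Matrix.mul_apply, Finset.sum_mul, Matrix.transpose_apply, gram,
      Matrix.of_apply]
    exact Finset.sum_congr rfl fun p _ => Finset.sum_congr rfl fun q _ => by ring
  have hquad : ∀ f, ∑ a, inner ℝ f (φ a) ^ 2 ≤ inner ℝ (hk.integralOperator f) f := by
    intro f
    refine le_trans (le_of_eq ?_) (hk.quadForm_le_inner_integralOperator Z f)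
    rw [← hB, ← Matrix.mulVec_mulVec, Matrix.dotProduct_mulVec, Matrix.vecMul_transpose]
    simp only [φ, inner_sum, real_inner_smul_right, hk.inner_toLp_right]
    exact Finset.sum_congr rfl fun a _ => sq _
  let ι : Fin (i + 1) → Fin l := Fin.castLE i.2
  have hι : Function.Injective ι := Fin.castLE_injective _
  have hle : ∀ j, d i ≤ d (ι j) := fun j => hd (Fin.le_def.2 (Nat.lt_succ_iff.1 j.2))
  refine hσ.le_of_quadratic_lower_bound hk.isCompactOperator_integralOperator
    hk.isSymmetric_integralOperator hk.inner_integralOperator_self_nonneg h0 (φ ∘ ι) ?_ fun a => ?_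
  · refine linearIndependent_of_ne_zero_of_inner_eq_zero (fun j hj => ?_) fun j j' hjj => ?_
    · have := hφ (ι j) (ι j)
      rw [if_pos rfl, show φ (ι j) = 0 from hj, inner_zero_left] at this
      linarith [hle j]
    · exact (hφ _ _).trans (if_neg fun h => hjj (hι h))
  · set f : Lp ℝ 2 μ := ∑ j, a j • (φ ∘ ι) j with hf
    have hfφ : ∀ j, inner ℝ f (φ (ι j)) = a j * d (ι j) := by
      intro j
      simp [hf, sum_inner, real_inner_smul_left, hφ, hι.eq_iff]
    have hnorm : ‖f‖ ^ 2 = ∑ j, a j ^ 2 * d (ι j) := by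
      rw [← real_inner_self_eq_norm_sq]
      nth_rewrite 2 [hf]
      rw [inner_sum]
      refine Finset.sum_congr rfl fun j _ => ?_
      rw [real_inner_smul_right, Function.comp_apply, hfφ]
      ring
    calc d i * ‖f‖ ^ 2 ≤ ∑ j, inner ℝ f (φ (ι j)) ^ 2 := by
          rw [hnorm, Finset.mul_sum]
          refine Finset.sum_le_sum fun j _ => ?_
          rw [hfφ]
          have h1 := mul_nonneg (mul_nonneg (sq_nonneg (a j)) (h0.le.trans (hle j)))
            (sub_nonneg.2 (hle j))
          linarith
      _ = ∑ m ∈ Finset.univ.map ⟨ι, hι⟩, inner ℝ f (φ m) ^ 2 := by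
          rw [Finset.sum_map]
          rfl
      _ ≤ ∑ m, inner ℝ f (φ m) ^ 2 :=
          Finset.sum_le_sum_of_subset_of_nonneg (Finset.subset_univ _) fun _ _ _ => sq_nonneg _
      _ ≤ _ := hquad f

theorem sum_tail_le_tsum {σ : ℕ → ℝ} (hσ0 : ∀ i, 0 ≤ σ i) (hσ : Summable σ) {d : Fin l → ℝ}
    (hd : ∀ i : Fin l, d i ≤ σ i) (s : ℕ) :
    ∑ i : Fin l, (if s ≤ (i : ℕ) then d i else 0) ≤ ∑' i, σ (i + s) := by
  calc ∑ i : Fin l, (if s ≤ (i : ℕ) then d i else 0)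
      ≤ ∑ i : Fin l, (if s ≤ (i : ℕ) then σ i else 0) :=
        Finset.sum_le_sum fun i _ => by split_ifs <;> [exact hd i; exact le_rfl]
    _ = ∑ i ∈ Finset.range l, (if s ≤ i then σ i else 0) :=
        Fin.sum_univ_eq_sum_range (fun i => if s ≤ i then σ i else 0) l
    _ = ∑ i ∈ Finset.Ico s l, σ i := by
        rw [← Finset.sum_filter]
        congr 1
        ext i
        simp [and_comm]
    _ = ∑ i ∈ Finset.range (l - s), σ (i + s) := by
        rw [Finset.sum_Ico_eq_sum_range]
        simp only [add_comm]
    _ ≤ _ := ((summable_nat_add_iff s).2 hσ).sum_le_tsum _ fun i _ => hσ0 _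

end IsIntegrableKernel

/-! ### Random samples -/

theorem conj_apply_eq_sum {l : ℕ} (B S : Matrix (Fin l) (Fin l) ℝ) (i : Fin l) :
    (B * S * Bᵀ) i i = ∑ b, ∑ a, B i a * B i b * S a b := by
  simp only [Matrix.mul_apply, Finset.sum_mul, Matrix.transpose_apply]
  exact Finset.sum_congr rfl fun b _ => Finset.sum_congr rfl fun a _ => by ring

section Sample

variable {E : Type*} [MeasurableSpace E] {μ : Measure E} {k : E → E → ℝ} {l M : ℕ}

theorem gram_squareKernel_empirical_apply (hk : IsIntegrableKernel k μ) (Z : Fin l → E)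
    (x : Fin M → E) (a b : Fin l) :
    gram (squareKernel k (empiricalMeasure x)) Z a b =
      (M : ℝ)⁻¹ * ∑ j, k (Z a) (x j) * k (x j) (Z b) :=
  integral_empiricalMeasure _ ((hk.measurable_right (Z a)).mul
    (hk.measurable.comp (measurable_id.prodMk measurable_const)))

theorem integrable_mul_right (hk : IsIntegrableKernel k μ) (x y : E) :
    Integrable (fun t => k x t * k t y) μ := by
  simp only [hk.symm _ y]
  exact (hk.memLp_right x).integrable_mul (hk.memLp_right y)

variable {Ω : Type*} [MeasurableSpace Ω] {P : Measure Ω} {X : Fin M → Ω → E}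

theorem integrable_gram_squareKernel_sample (hk : IsIntegrableKernel k μ) (Z : Fin l → E)
    (hlaw : ∀ j, HasLaw (X j) μ P) (a b : Fin l) :
    Integrable (fun ω => gram (squareKernel k (empiricalMeasure fun j => X j ω)) Z a b) P := by
  simp only [gram_squareKernel_empirical_apply hk]
  refine (integrable_finsetSum _ fun j _ => ?_).const_mul _
  have h := integrable_mul_right hk (Z a) (Z b)
  rw [← (hlaw j).map_eq] at h
  exact h.comp_aemeasurable (hlaw j).aemeasurable

theorem integral_gram_squareKernel_sample (hk : IsIntegrableKernel k μ) (hM : 0 < M)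
    (Z : Fin l → E) (hlaw : ∀ j, HasLaw (X j) μ P) (a b : Fin l) :
    ∫ ω, gram (squareKernel k (empiricalMeasure fun j => X j ω)) Z a b ∂P =
      gram (squareKernel k μ) Z a b := by
  have h := integrable_mul_right hk (Z a) (Z b)
  have hi : ∀ j, Integrable (fun ω => k (Z a) (X j ω) * k (X j ω) (Z b)) P := fun j => by
    have h' := h
    rw [← (hlaw j).map_eq] at h'
    exact h'.comp_aemeasurable (hlaw j).aemeasurable
  have he : ∀ j, ∫ ω, k (Z a) (X j ω) * k (X j ω) (Z b) ∂P = squareKernel k μ (Z a) (Z b) := by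
    intro j
    rw [squareKernel]
    have h' := h
    rw [← (hlaw j).map_eq] at h' ⊢
    exact (integral_map (hlaw j).aemeasurable h'.aestronglyMeasurable).symm
  simp only [gram_squareKernel_empirical_apply hk]
  rw [integral_const_mul, integral_finsetSum _ fun j _ => hi j]
  simp only [he, Finset.sum_const, Finset.card_univ, Fintype.card_fin, nsmul_eq_mul]
  rw [← mul_assoc, inv_mul_cancel₀ (by positivity), one_mul]
  rfl

theorem integrable_conj_gram_sample (hk : IsIntegrableKernel k μ) (Z : Fin l → E)
    (hlaw : ∀ j, HasLaw (X j) μ P) (B : Matrix (Fin l) (Fin l) ℝ) (i : Fin l) :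
    Integrable (fun ω => (B * gram (squareKernel k (empiricalMeasure fun j => X j ω)) Z * Bᵀ) i i)
      P := by
  simp only [conj_apply_eq_sum]
  exact integrable_finsetSum _ fun b _ => integrable_finsetSum _ fun a _ =>
    (integrable_gram_squareKernel_sample hk Z hlaw a b).const_mul _

theorem integral_conj_gram_sample (hk : IsIntegrableKernel k μ) (hM : 0 < M) (Z : Fin l → E)
    (hlaw : ∀ j, HasLaw (X j) μ P) (B : Matrix (Fin l) (Fin l) ℝ) (i : Fin l) :
    ∫ ω, (B * gram (squareKernel k (empiricalMeasure fun j => X j ω)) Z * Bᵀ) i i ∂P =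
      (B * gram (squareKernel k μ) Z * Bᵀ) i i := by
  have hi := fun a b => (integrable_gram_squareKernel_sample hk Z hlaw a b).const_mul
    (B i a * B i b)
  simp only [conj_apply_eq_sum]
  rw [integral_finsetSum _ fun b _ => integrable_finsetSum _ fun a _ => hi a b]
  refine Finset.sum_congr rfl fun b _ => ?_
  rw [integral_finsetSum _ fun a _ => hi a b]
  refine Finset.sum_congr rfl fun a _ => ?_
  rw [integral_const_mul, integral_gram_squareKernel_sample hk hM Z hlaw]

theorem aemeasurable_partialTraceInf_sample (hk : IsIntegrableKernel k μ) (Z : Fin l → E)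
    (hlaw : ∀ j, HasLaw (X j) μ P) (B : Matrix (Fin l) (Fin l) ℝ) (s : ℕ) :
    AEMeasurable (fun ω => partialTraceInf s
      (B * gram (squareKernel k (empiricalMeasure fun j => X j ω)) Z * Bᵀ)) P := by
  have hF : Continuous fun A : Fin l → Fin l → ℝ => partialTraceInf s (B * Matrix.of A * Bᵀ) := by
    refine (continuous_partialTraceInf s).comp ?_
    have h : Continuous fun A : Matrix (Fin l) (Fin l) ℝ => B * A * Bᵀ := by fun_prop
    exact h
  have hA : AEMeasurable (fun ω (a b : Fin l) =>
      gram (squareKernel k (empiricalMeasure fun j => X j ω)) Z a b) P :=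
    aemeasurable_pi_iff.2 fun a => aemeasurable_pi_iff.2 fun b =>
      (integrable_gram_squareKernel_sample hk Z hlaw a b).aemeasurable
  exact hF.measurable.comp_aemeasurable hA

end Sample

end Nystrom

theorem proposition4p7
    {E : Type*} [MeasurableSpace E] (μ : Measure E) [IsProbabilityMeasure μ]
    (k : E → E → ℝ) (hk : Nystrom.IsIntegrableKernel k μ)
    (σ : ℕ → ℝ) (hσ : Nystrom.IsEigenvalueSeq hk.integralOperator σ)
    {l : ℕ} (Z : Fin l → E) (s : ℕ)
    {Ω : Type*} [MeasurableSpace Ω] (P : Measure Ω) [IsProbabilityMeasure P]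
    {M : ℕ} (hM : 0 < M) (X : Fin M → Ω → E)
    (hlaw : ∀ j, HasLaw (X j) μ P) (hindep : iIndepFun X P)
    (D : ∀ ω, Nystrom.MercerData k Z (Nystrom.empiricalMeasure fun j => X j ω)) :
    Integrable (fun ω => Nystrom.diagIntegral (Nystrom.empiricalMeasure fun j => X j ω)
        (fun x y => Nystrom.nystromKernel k Z x y - (D ω).truncKernel s x y)) P ∧
    Integrable (fun ω => Nystrom.diagIntegral (Nystrom.empiricalMeasure fun j => X j ω)
        (fun x y => (D ω).kernel x y - (D ω).truncKernel s x y)) P ∧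
    ∫ ω, Nystrom.diagIntegral (Nystrom.empiricalMeasure fun j => X j ω)
        (fun x y => Nystrom.nystromKernel k Z x y - (D ω).truncKernel s x y) ∂P =
      ∫ ω, Nystrom.diagIntegral (Nystrom.empiricalMeasure fun j => X j ω)
        (fun x y => (D ω).kernel x y - (D ω).truncKernel s x y) ∂P ∧
    Summable (fun i => σ (i + s)) ∧
    ∫ ω, Nystrom.diagIntegral (Nystrom.empiricalMeasure fun j => X j ω)
        (fun x y => (D ω).kernel x y - (D ω).truncKernel s x y) ∂P ≤
      ∑' i, σ (i + s) := by
  have hsum := hk.summable_eigenvalues hσ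
  simp only [Nystrom.MercerData.diagIntegral_nystromKernel_sub hk.measurable hk.symm,
    Nystrom.MercerData.diagIntegral_kernel_sub hk.measurable hk.symm]
  obtain ⟨B, d, hB, hd, hBd⟩ := hk.exists_spectral_features Z
  have hterm : ∀ i : Fin l, Integrable (fun ω => if s ≤ (i : ℕ) then
      (B * Nystrom.gram (Nystrom.squareKernel k (Nystrom.empiricalMeasure fun j => X j ω)) Z *
        Bᵀ) i i else 0) P := fun i => by
    split_ifs
    · exact Nystrom.integrable_conj_gram_sample hk Z hlaw B i
    · exact integrable_zero _ _ _
  have hdom := integrable_finsetSum Finset.univ fun i _ => hterm i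
  have hint : Integrable (fun ω => ∑ i : Fin l, if s ≤ (i : ℕ) then (D ω).κ i else 0) P := by
    refine hdom.mono' ?_ (ae_of_all _ fun ω => ?_)
    · simp only [fun ω => (D ω).sum_tail_eq_partialTraceInf s hB]
      exact (Nystrom.aemeasurable_partialTraceInf_sample hk Z hlaw B s).aestronglyMeasurable
    · rw [Real.norm_of_nonneg (Finset.sum_nonneg fun i _ => by
        split_ifs <;> [exact (D ω).nonneg i; exact le_rfl])]
      exact (D ω).sum_tail_le s hB
  refine ⟨hint, hint, trivial, (summable_nat_add_iff s).2 hsum, ?_⟩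
  calc ∫ ω, ∑ i : Fin l, (if s ≤ (i : ℕ) then (D ω).κ i else 0) ∂P
      ≤ ∫ ω, ∑ i : Fin l, (if s ≤ (i : ℕ) then
          (B * Nystrom.gram (Nystrom.squareKernel k (Nystrom.empiricalMeasure fun j => X j ω)) Z *
            Bᵀ) i i else 0) ∂P := integral_mono hint hdom fun ω => (D ω).sum_tail_le s hB
    _ = ∑ i : Fin l, if s ≤ (i : ℕ) then d i else 0 := by
        rw [integral_finsetSum _ fun i _ => hterm i]
        refine Finset.sum_congr rfl fun i _ => ?_
        split_ifs
        · rw [Nystrom.integral_conj_gram_sample hk hM Z hlaw, hBd, Matrix.diagonal_apply_eq]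
        · simp
    _ ≤ _ := Nystrom.IsIntegrableKernel.sum_tail_le_tsum hσ.nonneg hsum
        (hk.spectral_features_le hσ Z hB hd hBd) s
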